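/- Let $k$ be a field and $S$ a separable $k$-algebra (not necessarily commutative; i.e. $S$ is projective as an $S\otimes_k S^{\mathrm{op}}$-module). All $S,S$-bimodules are over $k$, i.e. are $S\otimes_k S^{\mathrm{op}}$-modules, and $C^{n}$ denotes $C\otimes_S\cdots\otimes_S C$ ($n\ge 1$ factors). An $A_\infty$-coalgebra over $S$ is a $\mathbb Z$-graded $S,S$-bimodule $C$ with bimodule maps $\Delta_n\colon C\to C^{n}$ ($n\ge 1$) of degree $n-2$ (homological grading) such that, for each $x\in C$, $\Delta_n(x)\neq 0$ for only finitely many $n$, and such that the endomorphism $d$ of the non-unital tensor algebra $\bigoplus_{n\ge 1}C[1]^{n}$ (where $C[1]_m=C_{m+1}$) determined by $d=-\sum_n [1]^{\otimes n}\circ\Delta_n\circ[-1]$ on $C[1]$ and the graded Leibniz rule $d(xy)=dx\cdot y+(-1)^{\deg x}x\cdot dy$ satisfies $d^2=0$. The resulting non-unital dg algebra is the cobar construction $\Omega_\infty C$. A morphism $f\colon C'\to C$ of $A_\infty$-coalgebras is a family of bimodule maps $f_n\colon C'\to C^{n}$ ($n\ge 1$) of degree $n-1$, with $f_n(x)\ne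 0$ for only finitely many $n$ for each $x\in C'$, such that the algebra homomorphism $\Omega_\infty f\colon\Omega_\infty C'\to\Omega_\infty C$ given by $\sum_n[1]^{\otimes n}\circ f_n\circ[-1]$ on $C'[1]$ commutes with the differentials. It is a quasi-isomorphism if $f_1\colon (C',\Delta'_1)\to(C,\Delta_1)$ is a quasi-isomorphism of complexes, and a weak equivalence if $\Omega_\infty f$ is a quasi-isomorphism of dg algebras. A strictly positive grading on an $A_\infty$-coalgebra $C$ is a decomposition $C=\bigoplus_{i\ge 1}C(i)$ into graded sub-bimodules, additional to the homological grading, such that every $\Delta_n$ preserves the additional degree, i.e. $\Delta_n(C(i))\subseteq\bigoplus_{i_1+\cdots+i_n=i}C(i_1)\otimes_S\cdots\otimes_S C(i_n)$. A morphism $f$ is compatible with such gradings on $C'$ and $C$ if every $f_n$ preserves the additional degree. **Corollary 6.3.** Let $f\colon C'\to C$ be a morphism of $A_\infty$-coalgebras over $S$ which is compatible with strictly positive gradings on $C'$ and $C$. If $f$ is a quasi-isomorphism, then it is a weak equivalence, i.e. $\Omega_\infty f\colon\Omega_\infty C'\to\Omega_\infty C$ is a quasi-isomorphism of dg algebras.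 -/

import Mathlib

open scoped TensorProduct

noncomputable section

set_option linter.unusedSectionVars false

/-- A (not necessarily commutative) `k`-algebra `S` is *separable* if it is projective as a module
over its enveloping algebra `S ⊗[k] Sᵐᵒᵖ`, i.e. as an `S,S`-bimodule over `k`. -/
def IsSeparableAlg (k S : Type*) [Field k] [Ring S] [Algebra k S] : Prop :=
  letI : Module (S ⊗[k] Sᵐᵒᵖ) S := TensorProduct.Algebra.module
  Module.Projective (S ⊗[k] Sᵐᵒᵖ) S

/-! ### The tensor algebra of a bimodule

An `S,S`-bimodule over `k` is a `k`-module `C` with commuting actions of `S` (left) and `Sᵐᵒᵖ`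
(right) that both restrict to the given action of `k`. -/

section TensorAlgebra

universe u v w

variable (k : Type u) (S : Type v) (C : Type w) [Field k] [Ring S] [Algebra k S]
  [AddCommGroup C] [Module k C] [Module S C] [Module Sᵐᵒᵖ C]

/-- The relations that make `S → T` a homomorphism of `k`-algebras and `C → T` a homomorphism of
`S,S`-bimodules. -/
inductive BimodRel : FreeAlgebra k (S ⊕ C) → FreeAlgebra k (S ⊕ C) → Prop
  | algebraMap (r : k) : BimodRel (FreeAlgebra.ι k (Sum.inl (algebraMap k S r)))
      (algebraMap k (FreeAlgebra k (S ⊕ C)) r)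
  | add_left (s t : S) : BimodRel (FreeAlgebra.ι k (Sum.inl (s + t)))
      (FreeAlgebra.ι k (Sum.inl s) + FreeAlgebra.ι k (Sum.inl t))
  | mul_left (s t : S) : BimodRel (FreeAlgebra.ι k (Sum.inl (s * t)))
      (FreeAlgebra.ι k (Sum.inl s) * FreeAlgebra.ι k (Sum.inl t))
  | add_right (c d : C) : BimodRel (FreeAlgebra.ι k (Sum.inr (c + d)))
      (FreeAlgebra.ι k (Sum.inr c) + FreeAlgebra.ι k (Sum.inr d))
  | smul (s : S) (c : C) : BimodRel (FreeAlgebra.ι k (Sum.inr (s • c)))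
      (FreeAlgebra.ι k (Sum.inl s) * FreeAlgebra.ι k (Sum.inr c))
  | op_smul (s : S) (c : C) : BimodRel (FreeAlgebra.ι k (Sum.inr (MulOpposite.op s • c)))
      (FreeAlgebra.ι k (Sum.inr c) * FreeAlgebra.ι k (Sum.inl s))

/-- The (unital) tensor algebra `T_S(C) = S ⊕ C ⊕ (C ⊗_S C) ⊕ (C ⊗_S C ⊗_S C) ⊕ ⋯` of the
`S,S`-bimodule `C`, presented by generators and relations. It is the universal `k`-algebra with an
algebra map from `S` and a bimodule map from `C`. The tensor power `C ⊗_S ⋯ ⊗_S C`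
(`n` factors, `n ≥ 1`) is the subspace spanned by the products of `n` elements of `C`, and its
bimodule structure is given by multiplication by elements of `S` on either side. -/
def BimodTensor : Type (max u v w) := RingQuot (BimodRel k S C)

instance BimodTensor.instRing : Ring (BimodTensor k S C) :=
  inferInstanceAs (Ring (RingQuot (BimodRel k S C)))

instance BimodTensor.instAlgebra : Algebra k (BimodTensor k S C) :=
  inferInstanceAs (Algebra k (RingQuot (BimodRel k S C)))

namespace BimodTensor

/-- The quotient map from the free algebra. -/
def mk : FreeAlgebra k (S ⊕ C) →ₐ[k] BimodTensor k S C := RingQuot.mkAlgHom k (BimodRel k S C)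

variable {k S C}

theorem mk_rel {x y : FreeAlgebra k (S ⊕ C)} (h : BimodRel k S C x y) : mk k S C x = mk k S C y :=
  RingQuot.mkAlgHom_rel k h

theorem mk_surjective : Function.Surjective (mk k S C) := RingQuot.mkAlgHom_surjective k _

variable (k S C)

/-- The structure map `S → T_S(C)`. -/
def inS : S →ₐ[k] BimodTensor k S C :=
  AlgHom.mk'
    { toFun := fun s => mk k S C (FreeAlgebra.ι k (Sum.inl s))
      map_one' := by
        have := mk_rel (BimodRel.algebraMap (k := k) (S := S) (C := C) 1)
        simpa using this
      map_zero' := by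
        have := mk_rel (BimodRel.algebraMap (k := k) (S := S) (C := C) 0)
        simpa using this
      map_mul' := fun s t => by
        simpa using mk_rel (BimodRel.mul_left (k := k) (C := C) s t)
      map_add' := fun s t => by
        simpa using mk_rel (BimodRel.add_left (k := k) (C := C) s t) }
    (fun r s => by
      have h1 := mk_rel (BimodRel.mul_left (k := k) (C := C) (algebraMap k S r) s)
      have h2 := mk_rel (BimodRel.algebraMap (k := k) (S := S) (C := C) r)
      rw [Algebra.smul_def, Algebra.smul_def]
      simp only [RingHom.coe_mk, MonoidHom.coe_mk, OneHom.coe_mk]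
      rw [h1, map_mul, h2, AlgHom.commutes])

variable [IsScalarTower k S C]

/-- The inclusion `C → T_S(C)`. -/
def inC : C →ₗ[k] BimodTensor k S C where
  toFun c := mk k S C (FreeAlgebra.ι k (Sum.inr c))
  map_add' c d := by simpa using mk_rel (BimodRel.add_right (k := k) (S := S) c d)
  map_smul' r c := by
    have h1 := mk_rel (BimodRel.smul (k := k) (algebraMap k S r) c)
    have h2 := mk_rel (BimodRel.algebraMap (k := k) (S := S) (C := C) r)
    rw [algebraMap_smul] at h1
    rw [h1, map_mul, h2, AlgHom.commutes, RingHom.id_apply, Algebra.smul_def]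

variable {k S C}

theorem inC_smul (s : S) (c : C) : inC k S C (s • c) = inS k S C s * inC k S C c := by
  exact (mk_rel (BimodRel.smul (k := k) s c)).trans (map_mul _ _ _)

theorem inC_op_smul (s : S) (c : C) :
    inC k S C (MulOpposite.op s • c) = inC k S C c * inS k S C s := by
  exact (mk_rel (BimodRel.op_smul (k := k) s c)).trans (map_mul _ _ _)

@[elab_as_elim]
theorem induction {P : BimodTensor k S C → Prop} (hS : ∀ s, P (inS k S C s))
    (hC : ∀ c, P (inC k S C c)) (hadd : ∀ x y, P x → P y → P (x + y))
    (hmul : ∀ x y, P x → P y → P (x * y)) (x : BimodTensor k S C) : P x := by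
  obtain ⟨a, rfl⟩ := mk_surjective x
  induction a using FreeAlgebra.induction with
  | grade0 r =>
    have := hS (algebraMap k S r)
    rwa [AlgHom.commutes, ← AlgHom.commutes (mk k S C)] at this
  | grade1 x => rcases x with s | c; exacts [hS s, hC c]
  | mul a b ha hb => rw [map_mul]; exact hmul _ _ ha hb
  | add a b ha hb => rw [map_add]; exact hadd _ _ ha hb

section lift

variable {A : Type*} [Ring A] [Algebra k A]

/-- The universal property of the tensor algebra. -/
def lift (φ : S →ₐ[k] A) (g : C →ₗ[k] A) (hl : ∀ s c, g (s • c) = φ s * g c)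
    (hr : ∀ s c, g (MulOpposite.op s • c) = g c * φ s) : BimodTensor k S C →ₐ[k] A :=
  RingQuot.liftAlgHom k ⟨FreeAlgebra.lift k (Sum.elim φ g), by
    intro x y h
    cases h <;> simp [hl, hr]⟩

variable (φ : S →ₐ[k] A) (g : C →ₗ[k] A) (hl : ∀ s c, g (s • c) = φ s * g c)
  (hr : ∀ s c, g (MulOpposite.op s • c) = g c * φ s)

@[simp] theorem lift_inS (s : S) : lift φ g hl hr (inS k S C s) = φ s := by
  change RingQuot.liftAlgHom k _ (RingQuot.mkAlgHom k _ _) = _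
  rw [RingQuot.liftAlgHom_mkAlgHom_apply]; simp

@[simp] theorem lift_inC (c : C) : lift φ g hl hr (inC k S C c) = g c := by
  change RingQuot.liftAlgHom k _ (RingQuot.mkAlgHom k _ _) = _
  rw [RingQuot.liftAlgHom_mkAlgHom_apply]; simp

theorem algHom_ext {f g : BimodTensor k S C →ₐ[k] A} (hS : ∀ s, f (inS k S C s) = g (inS k S C s))
    (hC : ∀ c, f (inC k S C c) = g (inC k S C c)) : f = g := by
  ext x
  induction x using induction with
  | hS s => exact hS s
  | hC c => exact hC c
  | hadd x y hx hy => rw [map_add, map_add, hx, hy]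
  | hmul x y hx hy => rw [map_mul, map_mul, hx, hy]

end lift

variable (k S C)

/-- The augmentation `T_S(C) → S` that kills `C`. -/
def aug : BimodTensor k S C →ₐ[k] S := lift (AlgHom.id k S) 0 (by simp) (by simp)

@[simp] theorem aug_inS (s : S) : aug k S C (inS k S C s) = s := by simp [aug]

@[simp] theorem aug_inC (c : C) : aug k S C (inC k S C c) = 0 := by simp [aug]

/-- The non-unital tensor algebra `⨁_{n ≥ 1} C ⊗_S ⋯ ⊗_S C`, as the augmentation ideal of the
unital tensor algebra. -/
def plus : NonUnitalSubalgebra k (BimodTensor k S C) where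
  carrier := {x | aug k S C x = 0}
  zero_mem' := map_zero _
  add_mem' {x y} hx hy := by
    rw [Set.mem_ofPred_eq] at *; rw [map_add, hx, hy, add_zero]
  mul_mem' {x y} hx hy := by
    rw [Set.mem_ofPred_eq] at *; rw [map_mul, hx, zero_mul]
  smul_mem' r x hx := by
    rw [Set.mem_ofPred_eq] at *; rw [map_smul, hx, smul_zero]

variable {k S C}

theorem mem_plus {x : BimodTensor k S C} : x ∈ plus k S C ↔ aug k S C x = 0 := Iff.rfl

section proj

variable (k S C)
variable [SMulCommClass S Sᵐᵒᵖ C] [IsScalarTower k Sᵐᵒᵖ C]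

/-- The map from the tensor algebra to its quotient `S ⊕ C` by the products of two elements
of `C`. -/
def toTriv : BimodTensor k S C →ₐ[k] TrivSqZeroExt S C :=
  lift (TrivSqZeroExt.inlAlgHom k S C) (TrivSqZeroExt.inrHom S C |>.restrictScalars k)
    (by intro s c; ext <;> simp) (by intro s c; ext <;> simp)

/-- The projection of the tensor algebra onto its direct summand `C`. -/
def proj : BimodTensor k S C →ₗ[k] C :=
  (TrivSqZeroExt.sndHom S C).restrictScalars k ∘ₗ (toTriv k S C).toLinearMap

@[simp] theorem proj_inC (c : C) : proj k S C (inC k S C c) = c := by simp [proj, toTriv]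

@[simp] theorem proj_inS (s : S) : proj k S C (inS k S C s) = 0 := by simp [proj, toTriv]

variable {k S C}

theorem fst_toTriv (x : BimodTensor k S C) : (toTriv k S C x).fst = aug k S C x := by
  induction x using induction with
  | hS s => simp [toTriv]
  | hC c => simp [toTriv]
  | hadd x y hx hy => simp [hx, hy]
  | hmul x y hx hy => simp [hx, hy]

theorem proj_mul (x y : BimodTensor k S C) :
    proj k S C (x * y) = aug k S C x • proj k S C y + MulOpposite.op (aug k S C y) • proj k S C x := by
  simp [proj, fst_toTriv]

end proj

end BimodTensor

end TensorAlgebra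

open BimodTensor

/-! ### Graded bimodules and the cobar differential -/

section Graded

universe u v w w'

variable (k : Type u) (S : Type v) (C : Type w) [Field k] [Ring S] [Algebra k S]
  [AddCommGroup C] [Module k C] [Module S C] [Module Sᵐᵒᵖ C]

/-- A grading `C = ⨁ᵢ Cᵢ` of a bimodule by sub-bimodules. -/
structure BimodGrading (ι : Type*) [DecidableEq ι] where
  piece : ι → Submodule k C
  isInternal : DirectSum.IsInternal piece
  smul_mem : ∀ (i : ι) (s : S) (c : C), c ∈ piece i → s • c ∈ piece i
  op_smul_mem : ∀ (i : ι) (s : S) (c : C), c ∈ piece i → MulOpposite.op s • c ∈ piece i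

variable {k S C}

namespace BimodGrading

/-- The component of degree `i` of the `n`-fold tensor power `C ⊗_S ⋯ ⊗_S C`, for the grading
induced from a grading of `C`: it is spanned by the products of `n` homogeneous elements of `C`
with degrees adding up to `i`. (Only used for `n ≥ 1`.) -/
def tensorPiece [IsScalarTower k S C] {ι : Type*} [DecidableEq ι] [AddCommMonoid ι]
    (G : BimodGrading k S C ι) (n : ℕ) (i : ι) : Submodule k (BimodTensor k S C) :=
  Submodule.span k {x | ∃ (p : Fin n → ι) (c : Fin n → C), (∀ j, c j ∈ G.piece (p j)) ∧
    ∑ j, p j = i ∧ x = (List.ofFn fun j => inC k S C (c j)).prod}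

variable (gr : BimodGrading k S C ℤ)

theorem bijective : Function.Bijective (DirectSum.coeLinearMap gr.piece) := gr.isInternal

/-- The involution `c ↦ (-1)^{deg c} c` of a `ℤ`-graded bimodule. -/
def parity : C →ₗ[k] C :=
  (DirectSum.toModule k ℤ C fun n => ((n.negOnePow : ℤˣ) : ℤ) • (gr.piece n).subtype) ∘ₗ
    (LinearEquiv.ofBijective (DirectSum.coeLinearMap gr.piece) gr.bijective).symm.toLinearMap

theorem parity_of_mem {n : ℤ} {c : C} (hc : c ∈ gr.piece n) :
    gr.parity c = ((n.negOnePow : ℤˣ) : ℤ) • c := by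
  have : (LinearEquiv.ofBijective (DirectSum.coeLinearMap gr.piece) gr.bijective).symm c =
      DirectSum.lof k ℤ (fun n => gr.piece n) n ⟨c, hc⟩ := by
    rw [LinearEquiv.symm_apply_eq, LinearEquiv.ofBijective_apply, DirectSum.lof_eq_of]
    exact (DirectSum.coeLinearMap_of gr.piece n ⟨c, hc⟩).symm
  rw [parity, LinearMap.comp_apply, LinearEquiv.coe_coe, this, DirectSum.toModule_lof]
  rfl

theorem iSup_eq_top {ι : Type*} [DecidableEq ι] (G : BimodGrading k S C ι) :
    ⨆ i, G.piece i = ⊤ := G.isInternal.submodule_iSup_eq_top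

theorem parity_smul [SMulCommClass ℤ S C] (s : S) (c : C) :
    gr.parity (s • c) = s • gr.parity c := by
  have hc : c ∈ ⨆ i, gr.piece i := by rw [gr.iSup_eq_top]; trivial
  induction hc using Submodule.iSup_induction' with
  | mem i x hx => rw [gr.parity_of_mem hx, gr.parity_of_mem (gr.smul_mem i s x hx), smul_comm]
  | zero => simp
  | add x y _ _ hx hy => rw [smul_add, map_add, hx, hy, map_add, smul_add]

theorem parity_op_smul (s : S) (c : C) :
    gr.parity (MulOpposite.op s • c) = MulOpposite.op s • gr.parity c := by
  have hc : c ∈ ⨆ i, gr.piece i := by rw [gr.iSup_eq_top]; trivial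
  induction hc using Submodule.iSup_induction' with
  | mem i x hx => rw [gr.parity_of_mem hx, gr.parity_of_mem (gr.op_smul_mem i s x hx), smul_comm]
  | zero => simp
  | add x y _ _ hx hy => rw [smul_add, map_add, hx, hy, map_add, smul_add]

variable [IsScalarTower k S C]

/-- The automorphism of `T_S(C)` that multiplies `c₁ ⊗ ⋯ ⊗ cₙ` by `(-1)^{∑ deg cᵢ}`. -/
def tensorParity : BimodTensor k S C →ₐ[k] BimodTensor k S C :=
  lift (inS k S C) (inC k S C ∘ₗ gr.parity)
    (fun s c => by simp [parity_smul, inC_smul])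
    (fun s c => by simp [parity_op_smul, inC_op_smul])

/-- The automorphism of `T_S(C[1])` that multiplies `c₁ ⊗ ⋯ ⊗ cₙ` by
`(-1)^{∑ (deg cᵢ - 1)}`, i.e. by the parity of its degree in `C[1] ⊗_S ⋯ ⊗_S C[1]`. -/
def shiftParity : BimodTensor k S C →ₐ[k] BimodTensor k S C :=
  lift (inS k S C) (-(inC k S C ∘ₗ gr.parity))
    (fun s c => by simp [parity_smul, inC_smul])
    (fun s c => by simp [parity_op_smul, inC_op_smul])

/-- The right action of the tensor algebra on itself in which `s ∈ S` acts by `y ↦ y s` and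
`c ∈ C` acts by `y ↦ (-1)^{deg y} y c`. -/
def twistedAction : BimodTensor k S C →ₐ[k] (Module.End k (BimodTensor k S C))ᵐᵒᵖ :=
  lift
    (AlgHom.ofLinearMap
      ((MulOpposite.opLinearEquiv k).toLinearMap ∘ₗ
        (LinearMap.mul k (BimodTensor k S C)).flip ∘ₗ (inS k S C).toLinearMap)
      (by apply MulOpposite.unop_injective; ext; simp)
      (by
        intro s t
        apply MulOpposite.unop_injective; ext; simp [mul_assoc]))
    ((MulOpposite.opLinearEquiv k).toLinearMap ∘ₗ
      (LinearMap.lcomp k (BimodTensor k S C) gr.tensorParity.toLinearMap) ∘ₗ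
        (LinearMap.mul k (BimodTensor k S C)).flip ∘ₗ inC k S C)
    (by
      intro s c
      apply MulOpposite.unop_injective; ext
      simp [inC_smul, tensorParity, mul_assoc])
    (by
      intro s c
      apply MulOpposite.unop_injective; ext
      simp [inC_op_smul, mul_assoc])

theorem twistedAction_inS (s : S) (y : BimodTensor k S C) :
    (gr.twistedAction (inS k S C s)).unop y = y * inS k S C s := by
  simp [twistedAction]

theorem twistedAction_inC (c : C) (y : BimodTensor k S C) :
    (gr.twistedAction (inC k S C c)).unop y = gr.tensorParity y * inC k S C c := by
  simp [twistedAction]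

theorem twistedAction_mul (x x' y : BimodTensor k S C) :
    (gr.twistedAction (x * x')).unop y =
      (gr.twistedAction x').unop ((gr.twistedAction x).unop y) := by
  simp

/-- The `n`-th tensor power `[1]^{⊗n} : C^{⊗n} → C[1]^{⊗n}` of the degree shift, for all `n` at
once. As `C[1] = C` apart from the grading, it is an endomorphism of `T_S(C)`. By the Koszul sign
rule it is `c₁ ⊗ ⋯ ⊗ cₙ ↦ (-1)^{∑ (n - i) deg cᵢ} c₁ ⊗ ⋯ ⊗ cₙ`. -/
def suspension : BimodTensor k S C →ₗ[k] BimodTensor k S C where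
  toFun x := (gr.twistedAction x).unop 1
  map_add' x y := by simp
  map_smul' r x := by simp

theorem suspension_inS (s : S) : gr.suspension (inS k S C s) = inS k S C s := by
  change (gr.twistedAction _).unop 1 = _
  rw [twistedAction_inS, one_mul]

theorem suspension_inC (c : C) : gr.suspension (inC k S C c) = inC k S C c := by
  change (gr.twistedAction _).unop 1 = _
  rw [twistedAction_inC, map_one, one_mul]

theorem suspension_mul_inC (x : BimodTensor k S C) (c : C) :
    gr.suspension (x * inC k S C c) = gr.tensorParity (gr.suspension x) * inC k S C c := by
  change (gr.twistedAction _).unop 1 = _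
  rw [twistedAction_mul, twistedAction_inC]; rfl

theorem suspension_mul_inS (x : BimodTensor k S C) (s : S) :
    gr.suspension (x * inS k S C s) = gr.suspension x * inS k S C s := by
  change (gr.twistedAction _).unop 1 = _
  rw [twistedAction_mul, twistedAction_inS]; rfl

theorem twistedAction_inS_mul (s : S) (x : BimodTensor k S C) : ∀ y : BimodTensor k S C,
    (gr.twistedAction x).unop (inS k S C s * y) = inS k S C s * (gr.twistedAction x).unop y := by
  induction x using BimodTensor.induction with
  | hS t => intro y; rw [twistedAction_inS, twistedAction_inS, mul_assoc]
  | hC c =>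
    intro y
    rw [twistedAction_inC, twistedAction_inC, map_mul, ← mul_assoc]
    simp [tensorParity]
  | hadd a b ha hb => intro y; simp [ha, hb, mul_add]
  | hmul a b ha hb => intro y; rw [twistedAction_mul, twistedAction_mul, ha, hb]

theorem suspension_inS_mul (s : S) (x : BimodTensor k S C) :
    gr.suspension (inS k S C s * x) = inS k S C s * gr.suspension x := by
  change (gr.twistedAction _).unop 1 = _ * (gr.twistedAction _).unop 1
  rw [twistedAction_mul, twistedAction_inS, one_mul, ← twistedAction_inS_mul, mul_one]

theorem aug_suspension (x : BimodTensor k S C) :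
    aug k S C (gr.suspension x) = aug k S C x := by
  have key : ∀ y, aug k S C ((gr.twistedAction x).unop y) = aug k S C y * aug k S C x := by
    induction x using BimodTensor.induction with
    | hS t => intro y; rw [twistedAction_inS, map_mul]
    | hC c => intro y; rw [twistedAction_inC, map_mul]; simp
    | hadd a b ha hb => intro y; simp [ha, hb, mul_add]
    | hmul a b ha hb => intro y; rw [twistedAction_mul, hb, ha, map_mul, mul_assoc]
  exact (key 1).trans (by rw [map_one, one_mul])

theorem aug_prod (l : List C) (hl : l ≠ []) : aug k S C (l.map (inC k S C)).prod = 0 := by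
  cases l with
  | nil => exact absurd rfl hl
  | cons a l => simp

theorem aug_of_mem {ι : Type*} [DecidableEq ι] [AddCommMonoid ι] (G : BimodGrading k S C ι)
    {n : ℕ} (hn : n ≠ 0) {i : ι} {x : BimodTensor k S C} (hx : x ∈ G.tensorPiece n i) :
    aug k S C x = 0 := by
  induction hx using Submodule.span_induction with
  | mem x hx =>
    obtain ⟨p, c, -, -, rfl⟩ := hx
    have : (List.ofFn fun j => inC k S C (c j)) = (List.ofFn c).map (inC k S C) := by
      rw [List.map_ofFn]; rfl
    rw [this, aug_prod]
    simpa using hn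
  | zero => simp
  | add x y _ _ hx hy => simp [hx, hy]
  | smul r x _ hx => simp [hx]

section proj

variable [SMulCommClass S Sᵐᵒᵖ C] [IsScalarTower k Sᵐᵒᵖ C]

theorem proj_of_mem {ι : Type*} [DecidableEq ι] [AddCommMonoid ι] (G : BimodGrading k S C ι)
    {n : ℕ} (hn : 2 ≤ n) {i : ι} {x : BimodTensor k S C} (hx : x ∈ G.tensorPiece n i) :
    proj k S C x = 0 := by
  induction hx using Submodule.span_induction with
  | mem x hx =>
    obtain ⟨p, c, -, -, rfl⟩ := hx
    have : (List.ofFn fun j => inC k S C (c j)) = (List.ofFn c).map (inC k S C) := by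
      rw [List.map_ofFn]; rfl
    rw [this]
    have hl : 2 ≤ (List.ofFn c).length := by simpa using hn
    generalize List.ofFn c = l at hl
    match l, hl with
    | a :: b :: l, _ => rw [List.map_cons, List.prod_cons, proj_mul, aug_prod _ (by simp)]; simp
  | zero => simp
  | add x y _ _ hx hy => simp [hx, hy]
  | smul r x _ hx => simp [hx]

theorem aug_tensorParity (x : BimodTensor k S C) :
    aug k S C (gr.tensorParity x) = aug k S C x := by
  induction x using BimodTensor.induction with
  | hS t => simp [tensorParity]
  | hC c => simp [tensorParity]
  | hadd a b ha hb => simp [ha, hb]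
  | hmul a b ha hb => simp [ha, hb]

theorem aug_shiftParity (x : BimodTensor k S C) :
    aug k S C (gr.shiftParity x) = aug k S C x := by
  induction x using BimodTensor.induction with
  | hS t => simp [shiftParity]
  | hC c => simp [shiftParity]
  | hadd a b ha hb => simp [ha, hb]
  | hmul a b ha hb => simp [ha, hb]

theorem proj_suspension (x : BimodTensor k S C) :
    proj k S C (gr.suspension x) = proj k S C x := by
  have key : ∀ y, aug k S C ((gr.twistedAction x).unop y) = aug k S C (y * x) ∧
      proj k S C ((gr.twistedAction x).unop y) = proj k S C (y * x) := by
    induction x using BimodTensor.induction with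
    | hS t => intro y; rw [twistedAction_inS]; simp
    | hC c =>
      intro y
      rw [twistedAction_inC]
      simp [proj_mul, aug_tensorParity]
    | hadd a b ha hb => intro y; simp [ha, hb, mul_add]
    | hmul a b ha hb =>
      intro y
      rw [twistedAction_mul]
      refine ⟨?_, ?_⟩
      · rw [(hb _).1, map_mul, (ha _).1]; simp [mul_assoc]
      · rw [(hb _).2, proj_mul, (ha _).1, (ha _).2, ← proj_mul, mul_assoc]
  have := (key 1).2
  rwa [one_mul] at this

end proj

end BimodGrading

variable {C' : Type w'} [AddCommGroup C'] [Module k C'] [Module S C'] [Module Sᵐᵒᵖ C']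
  [IsScalarTower k S C]

/-- A locally finite family of homomorphisms of bimodules `Fₙ : C' → C ⊗_S ⋯ ⊗_S C` (`n` factors)
for `n ≥ 1`, where `Fₙ` is homogeneous of degree `n - e`. Locally finite means that for each
`c ∈ C'` only finitely many `Fₙ(c)` are nonzero. The value at `n = 0` is a dummy. -/
structure TensorFamily (gr' : BimodGrading k S C' ℤ) (gr : BimodGrading k S C ℤ) (e : ℤ) where
  comp : ℕ → C' →ₗ[k] BimodTensor k S C
  comp_zero : comp 0 = 0
  comp_mem : ∀ (n : ℕ) (m : ℤ) (c : C'), c ∈ gr'.piece m →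
    comp n c ∈ gr.tensorPiece n (m + (n - e))
  comp_smul : ∀ (n : ℕ) (s : S) (c : C'), comp n (s • c) = inS k S C s * comp n c
  comp_op_smul : ∀ (n : ℕ) (s : S) (c : C'),
    comp n (MulOpposite.op s • c) = comp n c * inS k S C s
  finite : ∀ c : C', {n | comp n c ≠ 0}.Finite

namespace TensorFamily

variable {gr' : BimodGrading k S C' ℤ} {gr : BimodGrading k S C ℤ} {e : ℤ}
  (F : TensorFamily gr' gr e)

theorem support_finite (c : C') :
    (Function.support fun n => gr.suspension (F.comp n c)).Finite :=
  (F.finite c).subset fun n hn h0 => hn (by simp [h0])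

/-- The map `∑ₙ [1]^{⊗n} ∘ Fₙ ∘ [-1] : C'[1] → T_S(C[1])`. -/
def total : C' →ₗ[k] BimodTensor k S C where
  toFun c := ∑ᶠ n, gr.suspension (F.comp n c)
  map_add' c d := by
    rw [← finsum_add_distrib (F.support_finite c) (F.support_finite d)]
    simp
  map_smul' r c := by
    rw [RingHom.id_apply, smul_finsum' _ (F.support_finite c)]
    simp

theorem total_apply (c : C') : F.total c = ∑ᶠ n, gr.suspension (F.comp n c) := rfl

theorem total_smul (s : S) (c : C') : F.total (s • c) = inS k S C s * F.total c := by
  rw [total_apply, total_apply, mul_finsum' _ _ (F.support_finite c)]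
  simp [F.comp_smul, BimodGrading.suspension_inS_mul]

theorem total_op_smul (s : S) (c : C') :
    F.total (MulOpposite.op s • c) = F.total c * inS k S C s := by
  rw [total_apply, total_apply, finsum_mul' _ _ (F.support_finite c)]
  simp [F.comp_op_smul, BimodGrading.suspension_mul_inS]

theorem aug_comp (n : ℕ) (c : C') : aug k S C (F.comp n c) = 0 := by
  rcases eq_or_ne n 0 with rfl | hn
  · simp [F.comp_zero]
  have hc : c ∈ ⨆ i, gr'.piece i := by rw [gr'.iSup_eq_top]; trivial
  induction hc using Submodule.iSup_induction' with
  | mem i x hx => exact gr.aug_of_mem hn (F.comp_mem n i x hx)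
  | zero => simp
  | add x y _ _ hx hy => simp [hx, hy]

theorem aug_total (c : C') : aug k S C (F.total c) = 0 := by
  have h := (aug k S C).toAddMonoidHom.map_finsum (F.support_finite c)
  rw [total_apply]
  refine h.trans ?_
  simp [BimodGrading.aug_suspension, F.aug_comp]

section linearPart

variable [SMulCommClass S Sᵐᵒᵖ C] [IsScalarTower k Sᵐᵒᵖ C]

/-- The first component `F₁`, as a map `C' → C`. -/
def linearPart : C' →ₗ[k] C := proj k S C ∘ₗ F.comp 1

theorem proj_comp (n : ℕ) (hn : n ≠ 1) (c : C') : proj k S C (F.comp n c) = 0 := by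
  rcases eq_or_ne n 0 with rfl | h0
  · simp [F.comp_zero]
  have hc : c ∈ ⨆ i, gr'.piece i := by rw [gr'.iSup_eq_top]; trivial
  induction hc using Submodule.iSup_induction' with
  | mem i x hx => exact gr.proj_of_mem (by omega) (F.comp_mem n i x hx)
  | zero => simp
  | add x y _ _ hx hy => simp [hx, hy]

theorem proj_total (c : C') : proj k S C (F.total c) = F.linearPart c := by
  have h := (proj k S C).toAddMonoidHom.map_finsum (F.support_finite c)
  rw [total_apply]
  refine h.trans ?_
  rw [finsum_eq_single _ 1]
  · exact gr.proj_suspension _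
  · intro n hn
    exact (gr.proj_suspension _).trans (F.proj_comp n hn c)

theorem inC_linearPart (c : C') : inC k S C (F.linearPart c) = F.comp 1 c := by
  have hc : c ∈ ⨆ i, gr'.piece i := by rw [gr'.iSup_eq_top]; trivial
  induction hc using Submodule.iSup_induction' with
  | mem i x hx =>
    have h := F.comp_mem 1 i x hx
    change inC k S C (proj k S C (F.comp 1 x)) = _
    generalize F.comp 1 x = y at h
    induction h using Submodule.span_induction with
    | mem x hx =>
      obtain ⟨p, c, -, -, rfl⟩ := hx
      simp
    | zero => simp
    | add x y _ _ hx hy => simp [hx, hy]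
    | smul r x _ hx => simp [hx]
  | zero => simp
  | add x y _ _ hx hy => simp [hx, hy]

theorem linearPart_smul (s : S) (c : C') : F.linearPart (s • c) = s • F.linearPart c := by
  simp [linearPart, F.comp_smul, proj_mul]

theorem linearPart_op_smul (s : S) (c : C') :
    F.linearPart (MulOpposite.op s • c) = MulOpposite.op s • F.linearPart c := by
  simp [linearPart, F.comp_op_smul, proj_mul]

end linearPart

variable [IsScalarTower k S C']

/-- The homomorphism of algebras `T_S(C'[1]) → T_S(C[1])` given by `∑ₙ [1]^{⊗n} ∘ Fₙ ∘ [-1]` on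
generators, and by the identity on `S`. -/
def algHom : BimodTensor k S C' →ₐ[k] BimodTensor k S C :=
  lift (inS k S C) F.total F.total_smul F.total_op_smul

@[simp] theorem algHom_inS (s : S) : F.algHom (inS k S C' s) = inS k S C s := by simp [algHom]

@[simp] theorem algHom_inC (c : C') : F.algHom (inC k S C' c) = F.total c := by simp [algHom]

theorem aug_algHom (x : BimodTensor k S C') : aug k S C (F.algHom x) = aug k S C' x := by
  induction x using BimodTensor.induction with
  | hS t => simp
  | hC c => simp [F.aug_total]
  | hadd a b ha hb => simp [ha, hb]
  | hmul a b ha hb => simp [ha, hb]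

theorem proj_algHom [SMulCommClass S Sᵐᵒᵖ C] [IsScalarTower k Sᵐᵒᵖ C]
    [SMulCommClass S Sᵐᵒᵖ C'] [IsScalarTower k Sᵐᵒᵖ C'] (x : BimodTensor k S C') :
    proj k S C (F.algHom x) = F.linearPart (proj k S C' x) := by
  induction x using BimodTensor.induction with
  | hS t => simp
  | hC c => simp [F.proj_total]
  | hadd a b ha hb => simp [ha, hb]
  | hmul a b ha hb =>
    simp [proj_mul, ha, hb, F.aug_algHom, linearPart_smul, linearPart_op_smul]

end TensorFamily

namespace TensorFamily

variable {gr : BimodGrading k S C ℤ} {e : ℤ} (F : TensorFamily gr gr e)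

/-- The algebra map `x ↦ !![(-1)^{|x|} x, D x; 0, x]`, which encodes the derivation `D` below. -/
def derivMatrix : BimodTensor k S C →ₐ[k] Matrix (Fin 2) (Fin 2) (BimodTensor k S C) :=
  lift
    ((Matrix.diagonalAlgHom k).comp ((Pi.constAlgHom k (Fin 2) _).comp (inS k S C)))
    { toFun := fun c => !![gr.shiftParity (inC k S C c), -F.total c; 0, inC k S C c]
      map_add' := fun c d => by
        ext i j; fin_cases i <;> fin_cases j <;> simp [add_comm]
      map_smul' := fun r c => by
        ext i j; fin_cases i <;> fin_cases j <;> simp }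
    (fun s c => by
      ext i j
      fin_cases i <;> fin_cases j <;>
        simp [Matrix.mul_apply, inC_smul, F.total_smul, BimodGrading.shiftParity,
          BimodGrading.parity_smul])
    (fun s c => by
      ext i j
      fin_cases i <;> fin_cases j <;>
        simp [Matrix.mul_apply, inC_op_smul, F.total_op_smul, BimodGrading.shiftParity,
          BimodGrading.parity_op_smul])

theorem derivMatrix_apply (x : BimodTensor k S C) :
    F.derivMatrix x 0 0 = gr.shiftParity x ∧ F.derivMatrix x 1 0 = 0 ∧
      F.derivMatrix x 1 1 = x := by
  induction x using BimodTensor.induction with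
  | hS t => simp [derivMatrix, BimodGrading.shiftParity]
  | hC c => simp [derivMatrix]
  | hadd a b ha hb => simp [ha, hb]
  | hmul a b ha hb => simp [Matrix.mul_apply, ha, hb]

/-- The endomorphism `D` of `T_S(C[1])` that vanishes on `S`, equals
`-∑ₙ [1]^{⊗n} ∘ Fₙ ∘ [-1]` on `C[1]` and satisfies the graded Leibniz rule
`D (x y) = D x y + (-1)^{|x|} x D y`, where `|x|` is the degree in `T_S(C[1])`. -/
def derivation : BimodTensor k S C →ₗ[k] BimodTensor k S C where
  toFun x := F.derivMatrix x 0 1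
  map_add' x y := by simp
  map_smul' r x := by simp

@[simp] theorem derivation_inS (s : S) : F.derivation (inS k S C s) = 0 := by
  simp [derivation, derivMatrix]

@[simp] theorem derivation_inC (c : C) : F.derivation (inC k S C c) = -F.total c := by
  simp [derivation, derivMatrix]

theorem derivation_mul (x y : BimodTensor k S C) :
    F.derivation (x * y) = F.derivation x * y + gr.shiftParity x * F.derivation y := by
  simp [derivation, Matrix.mul_apply, F.derivMatrix_apply, add_comm]

theorem aug_derivation (x : BimodTensor k S C) : aug k S C (F.derivation x) = 0 := by
  induction x using BimodTensor.induction with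
  | hS t => simp
  | hC c => simp [F.aug_total]
  | hadd a b ha hb => simp [ha, hb]
  | hmul a b ha hb => simp [derivation_mul, ha, hb]

theorem proj_derivation [SMulCommClass S Sᵐᵒᵖ C] [IsScalarTower k Sᵐᵒᵖ C]
    (x : BimodTensor k S C) :
    proj k S C (F.derivation x) = -F.linearPart (proj k S C x) := by
  induction x using BimodTensor.induction with
  | hS t => simp
  | hC c => simp [F.proj_total]
  | hadd a b ha hb => simp [ha, hb, add_comm]
  | hmul a b ha hb =>
    simp [derivation_mul, proj_mul, ha, hb, F.aug_derivation, gr.aug_shiftParity,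
      linearPart_smul, linearPart_op_smul, add_comm]

end TensorFamily

end Graded

/-! ### Homology -/

section Homology

variable {k : Type*} [Field k] {M M' : Type*} [AddCommGroup M] [Module k M] [AddCommGroup M']
  [Module k M']

/-- The total homology `ker d / im d` of a complex `(M, d)`, i.e. of the direct sum of its terms. -/
abbrev TotalHomology (d : M →ₗ[k] M) : Type _ :=
  LinearMap.ker d ⧸ (LinearMap.range d).comap (LinearMap.ker d).subtype

/-- The map on homology induced by a map of complexes. -/
def TotalHomology.map (d' : M' →ₗ[k] M') (d : M →ₗ[k] M) (f : M' →ₗ[k] M)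
    (h : f ∘ₗ d' = d ∘ₗ f) : TotalHomology d' →ₗ[k] TotalHomology d :=
  Submodule.mapQ _ _
    (f.restrict (p := LinearMap.ker d') (q := LinearMap.ker d) fun x hx => by
      have := LinearMap.congr_fun h x
      rw [LinearMap.mem_ker] at *
      simpa [hx] using this.symm)
    (by
      rintro ⟨x, hx⟩ ⟨y, rfl⟩
      exact ⟨f y, (LinearMap.congr_fun h y).symm⟩)

/-- A map of complexes is a quasi-isomorphism if it induces a bijection on homology. -/
def IsQuasiIsoOf (d' : M' →ₗ[k] M') (d : M →ₗ[k] M) (f : M' →ₗ[k] M)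
    (h : f ∘ₗ d' = d ∘ₗ f) : Prop :=
  Function.Bijective (TotalHomology.map d' d f h)

end Homology

/-! ### A∞-coalgebras -/

section AInf

universe u v w w'

variable (k : Type u) (S : Type v) (C : Type w) [Field k] [Ring S] [Algebra k S]
  [AddCommGroup C] [Module k C] [Module S C] [Module Sᵐᵒᵖ C]
  [SMulCommClass S Sᵐᵒᵖ C] [IsScalarTower k S C] [IsScalarTower k Sᵐᵒᵖ C]

/-- An `A∞`-coalgebra structure over `S` on the `S,S`-bimodule `C`: a `ℤ`-grading and a locally
finite family of bimodule homomorphisms `Δₙ : C → C ⊗_S ⋯ ⊗_S C` (`n` factors, `n ≥ 1`) of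
degree `n - 2` (homological grading), such that the derivation `d` of the tensor algebra
`T_S(C[1])` with `d = -∑ₙ [1]^{⊗n} ∘ Δₙ ∘ [-1]` on `C[1]` satisfies `d² = 0`. The latter packages
the relations `∑_{r+s+t=n} (-1)^{r+st} (1^{⊗r} ⊗ Δ_s ⊗ 1^{⊗t}) ∘ Δ_{r+1+t} = 0` for `n ≥ 1`. -/
structure AInfCoalgebra where
  gr : BimodGrading k S C ℤ
  Δ : TensorFamily gr gr 2
  d_comp_d : Δ.derivation ∘ₗ Δ.derivation = 0

variable {k S C}

namespace AInfCoalgebra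

variable (X : AInfCoalgebra k S C)

/-- The differential of the underlying complex of an `A∞`-coalgebra. -/
def Δ₁ : C →ₗ[k] C := X.Δ.linearPart

theorem Δ₁_comp_Δ₁ : X.Δ₁ ∘ₗ X.Δ₁ = 0 := by
  ext c
  have h := congrArg (proj k S C) (LinearMap.congr_fun X.d_comp_d (inC k S C c))
  simpa [TensorFamily.proj_derivation, TensorFamily.proj_total, Δ₁] using h

/-- The underlying algebra of the cobar construction `Ω_∞ C`: the non-unital tensor algebra
`⨁_{n ≥ 1} C[1] ⊗_S ⋯ ⊗_S C[1]`. -/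
abbrev cobar (_ : AInfCoalgebra k S C) : NonUnitalSubalgebra k (BimodTensor k S C) := plus k S C

/-- The differential of the cobar construction `Ω_∞ C`. -/
def cobarD : X.cobar →ₗ[k] X.cobar where
  toFun x := ⟨X.Δ.derivation x, X.Δ.aug_derivation x⟩
  map_add' x y := by ext; simp
  map_smul' r x := by ext; simp

theorem cobarD_comp_cobarD : X.cobarD ∘ₗ X.cobarD = 0 := by
  ext x
  exact LinearMap.congr_fun X.d_comp_d (x : BimodTensor k S C)

/-- A strictly positive grading on an `A∞`-coalgebra, in addition to its homological grading: a
decomposition `C = ⨁_{i ≥ 1} C(i)` into graded sub-bimodules such that each `Δₙ` preserves the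
additional degree. -/
structure PositiveGrading extends BimodGrading k S C ℕ where
  piece_zero : piece 0 = ⊥
  /-- Each piece is the sum of its homogeneous parts for the homological grading. -/
  isGraded : ∀ i, piece i ≤ ⨆ n, piece i ⊓ X.gr.piece n
  Δ_mem : ∀ (n i : ℕ) (c : C), c ∈ piece i → X.Δ.comp n c ∈ toBimodGrading.tensorPiece n i

variable {C' : Type w'} [AddCommGroup C'] [Module k C'] [Module S C'] [Module Sᵐᵒᵖ C']
  [SMulCommClass S Sᵐᵒᵖ C'] [IsScalarTower k S C'] [IsScalarTower k Sᵐᵒᵖ C']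

/-- A morphism of `A∞`-coalgebras: a locally finite family of bimodule homomorphisms
`fₙ : C' → C ⊗_S ⋯ ⊗_S C` (`n` factors, `n ≥ 1`) of degree `n - 1`, such that the induced algebra
homomorphism between the cobar constructions, equal to `∑ₙ [1]^{⊗n} ∘ fₙ ∘ [-1]` on `C'[1]`,
commutes with the differentials. -/
structure Hom (X' : AInfCoalgebra k S C') (X : AInfCoalgebra k S C) where
  comps : TensorFamily X'.gr X.gr 1
  comm : comps.algHom.toLinearMap ∘ₗ X'.Δ.derivation = X.Δ.derivation ∘ₗ comps.algHom.toLinearMap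

namespace Hom

variable {X' : AInfCoalgebra k S C'} {X : AInfCoalgebra k S C} (f : Hom X' X)

/-- The first component of a morphism, a map of the underlying complexes. -/
def f₁ : C' →ₗ[k] C := f.comps.linearPart

theorem f₁_comm : f.f₁ ∘ₗ X'.Δ₁ = X.Δ₁ ∘ₗ f.f₁ := by
  ext c
  have h := congrArg (proj k S C) (LinearMap.congr_fun f.comm (inC k S C' c))
  simpa [TensorFamily.proj_derivation, TensorFamily.proj_total, TensorFamily.proj_algHom,
    f₁, Δ₁] using h

/-- The homomorphism of (non-unital) algebras `Ω_∞ f : Ω_∞ C' → Ω_∞ C`. -/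
def cobarMap : X'.cobar →ₙₐ[k] X.cobar where
  toFun x := ⟨f.comps.algHom x, (f.comps.aug_algHom x).trans x.2⟩
  map_smul' r x := by ext; simp
  map_zero' := by ext; simp
  map_add' x y := by ext; simp
  map_mul' x y := by ext; simp

theorem cobarMap_comm :
    (f.cobarMap : X'.cobar →ₗ[k] X.cobar) ∘ₗ X'.cobarD =
      X.cobarD ∘ₗ (f.cobarMap : X'.cobar →ₗ[k] X.cobar) := by
  ext x
  exact LinearMap.congr_fun f.comm (x : BimodTensor k S C')

/-- `f` is a quasi-isomorphism if `f₁` is a quasi-isomorphism of the underlying complexes. -/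
def IsQuasiIso : Prop := IsQuasiIsoOf X'.Δ₁ X.Δ₁ f.f₁ f.f₁_comm

/-- `f` is a weak equivalence if `Ω_∞ f` is a quasi-isomorphism of dg algebras. -/
def IsWeakEquivalence : Prop :=
  IsQuasiIsoOf X'.cobarD X.cobarD (f.cobarMap : X'.cobar →ₗ[k] X.cobar) f.cobarMap_comm

/-- `f` is compatible with strictly positive gradings of `C'` and `C` if each `fₙ` preserves the
additional degree. -/
def IsCompatible (G' : X'.PositiveGrading) (G : X.PositiveGrading) : Prop :=
  ∀ (n i : ℕ) (c : C'), c ∈ G'.piece i → f.comps.comp n c ∈ G.tensorPiece n i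

end Hom

end AInfCoalgebra

end AInf

end

/-! The proof is a perturbation argument on the mapping cone of `Ω_∞ f`. Dropping all components
with `n ≥ 2` leaves `Δ₁` and `f₁`, which induce a derivation `D₁` and an algebra map `T(f₁)` on
tensor algebras. Over a field the quasi-isomorphism `f₁` has a homotopy inverse `g` with homotopies
`h'` and `h`. Passing to components of the right degrees and averaging over a separability
idempotent makes all three homogeneous bimodule maps (`IsHomotopyInverse.exists_isBigradedHom`).
Only then do they extend to tensor algebras: `g` to the algebra map `T(g)`, and `h` to a twisted
derivation `K` with `D₁ K + K D₁ = T(f₁ g) - 1` (`tensor_homotopy`), likewise `h'` to `K'`.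

The components with `n ≥ 2` raise tensor length. Hence `T(g)`, `K'` and `K` contract the cone of the
full map up to an error `N` whose square raises the length filtration (`cone_acyclic_of_filtered`).
As additional degrees are at least `1`, a nonzero product of additional degree `w` has at most `w`
factors, so `N` is locally nilpotent, and a complex that is contractible up to such an error is
acyclic (`acyclic_of_locally_nilpotent`).

All maps involved are algebra maps or twisted derivations, or composites and differences of these,
so the length estimates reduce to generators. The argument runs in the unital tensor algebra; the
passage to the augmentation ideal is a small correction at the end. -/

noncomputable section

set_option linter.unusedSectionVars false

open BimodTensor

/-! ### Quasi-isomorphisms, acyclic cones and homotopy inverses over a field. -/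

section HomotopyInverse

variable {k : Type*} [Field k] {M M' : Type*} [AddCommGroup M] [Module k M] [AddCommGroup M']
  [Module k M']

theorem isQuasiIsoOf_iff (d' : M' →ₗ[k] M') (d : M →ₗ[k] M) (f : M' →ₗ[k] M)
    (h : f ∘ₗ d' = d ∘ₗ f) :
    IsQuasiIsoOf d' d f h ↔
      (∀ x' y, d' x' = 0 → f x' = d y → ∃ z, d' z = x') ∧
        ∀ x, d x = 0 → ∃ x' y, d' x' = 0 ∧ f x' + d y = x := by
  unfold IsQuasiIsoOf Function.Bijective
  refine and_congr ?_ ?_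
  · rw [← LinearMap.ker_eq_bot, LinearMap.ker_eq_bot']
    constructor
    · intro H x' y hx' hy
      have := H (Submodule.Quotient.mk ⟨x', hx'⟩)
        ((Submodule.Quotient.mk_eq_zero _).2 ⟨y, hy.symm⟩)
      obtain ⟨z, hz⟩ := (Submodule.Quotient.mk_eq_zero _).1 this
      exact ⟨z, hz⟩
    · intro H a ha
      obtain ⟨⟨x', hx'⟩, rfl⟩ := Submodule.Quotient.mk_surjective _ a
      obtain ⟨y, hy⟩ := (Submodule.Quotient.mk_eq_zero _).1 ha
      obtain ⟨z, hz⟩ := H x' y hx' hy.symm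
      exact (Submodule.Quotient.mk_eq_zero _).2 ⟨z, hz⟩
  · constructor
    · intro H x hx
      obtain ⟨a, ha⟩ := H (Submodule.Quotient.mk ⟨x, hx⟩)
      obtain ⟨⟨x', hx'⟩, rfl⟩ := Submodule.Quotient.mk_surjective _ a
      obtain ⟨y, hy⟩ := (Submodule.Quotient.eq _).1 ha.symm
      refine ⟨x', y, hx', ?_⟩
      have hy' : d y = x - f x' := hy
      rw [hy', add_sub_cancel]
    · intro H b
      obtain ⟨⟨x, hx⟩, rfl⟩ := Submodule.Quotient.mk_surjective _ b
      obtain ⟨x', y, hx', hy⟩ := H x hx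
      refine ⟨Submodule.Quotient.mk ⟨x', hx'⟩, Eq.symm ((Submodule.Quotient.eq _).2 ⟨y, ?_⟩)⟩
      change d y = x - f x'
      rw [← hy, add_sub_cancel_left]

/-- The differential of the mapping cone of `f`. -/
def coneD (d' : M' →ₗ[k] M') (d : M →ₗ[k] M) (f : M' →ₗ[k] M) : M' × M →ₗ[k] M' × M :=
  (-(d' ∘ₗ LinearMap.fst k M' M)).prod (f.coprod d)

@[simp] theorem coneD_apply (d' : M' →ₗ[k] M') (d : M →ₗ[k] M) (f : M' →ₗ[k] M) (x : M' × M) :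
    coneD d' d f x = (-d' x.1, f x.1 + d x.2) := rfl

/-- Injectivity on homology removes the first entry of a cone cycle up to a boundary, and
surjectivity then removes the second. Conversely, the cone cycles `(x', -y)` and `(0, x)` encode the
two conditions. -/
theorem isQuasiIsoOf_iff_cone (d' : M' →ₗ[k] M') (d : M →ₗ[k] M) (f : M' →ₗ[k] M)
    (h : f ∘ₗ d' = d ∘ₗ f) :
    IsQuasiIsoOf d' d f h ↔ ∀ x, coneD d' d f x = 0 → ∃ y, coneD d' d f y = x := by
  have hc : ∀ x, f (d' x) = d (f x) := LinearMap.congr_fun h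
  rw [isQuasiIsoOf_iff]
  constructor
  · rintro ⟨hi, hs⟩ ⟨x', x⟩ hx
    simp only [coneD_apply, Prod.mk_eq_zero, neg_eq_zero] at hx
    obtain ⟨z, rfl⟩ := hi x' (-x) hx.1 (by rw [map_neg, eq_neg_iff_add_eq_zero, hx.2])
    obtain ⟨x'', y, hx'', hy⟩ := hs (x + f z) (by rw [map_add, ← hc, add_comm, hx.2])
    refine ⟨(x'' - z, y), ?_⟩
    simp only [coneD_apply, map_sub, hx'', zero_sub, neg_neg, Prod.mk.injEq, true_and]
    rw [← add_sub_right_comm, hy, add_sub_cancel_right]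
  · intro H
    constructor
    · intro x' y hx' hy
      obtain ⟨⟨z, w⟩, hz⟩ := H (x', -y) (by simp [hx', hy])
      exact ⟨-z, by simpa using congrArg Prod.fst hz⟩
    · intro x hx
      obtain ⟨⟨z, w⟩, hz⟩ := H (0, x) (by simp [hx])
      simp only [coneD_apply, Prod.mk.injEq, neg_eq_zero] at hz
      exact ⟨z, w, hz⟩

/-- An acyclic complex of vector spaces is contractible. -/
theorem exists_contraction (d : M →ₗ[k] M) (hd : ∀ x, d (d x) = 0)
    (hex : ∀ x, d x = 0 → ∃ y, d y = x) : ∃ s : M →ₗ[k] M, ∀ x, d (s x) + s (d x) = x := by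
  obtain ⟨r, hr⟩ := d.rangeRestrict.exists_rightInverse_of_surjective d.range_rangeRestrict
  obtain ⟨σ, hσ⟩ := LinearMap.exists_extend r
  have key : ∀ x, d (σ (d x)) = d x := fun x => by
    have h1 := LinearMap.congr_fun hσ ⟨d x, x, rfl⟩
    have h2 := congrArg Subtype.val (LinearMap.congr_fun hr ⟨d x, x, rfl⟩)
    simp only [LinearMap.comp_apply, Submodule.subtype_apply] at h1
    rw [h1]
    exact h2
  -- `σ` is a linear section of `d` over its image, so `d σ d = d`. The correction term is needed
  -- because `σ σ d` need not vanish: the cycle `x - σ (d x)` is a boundary, hence fixed by `d σ`,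
  -- and this is the required identity.
  refine ⟨σ - d ∘ₗ σ ∘ₗ σ, fun x => ?_⟩
  obtain ⟨y, hy⟩ := hex (x - σ (d x)) (by rw [map_sub, key, sub_self])
  have h3 := key y
  rw [hy, map_sub, map_sub] at h3
  simp only [LinearMap.sub_apply, LinearMap.comp_apply, map_sub, hd, sub_zero]
  rw [add_sub_left_comm, h3]
  abel

/-- `g` is a homotopy inverse of the map of complexes `f : (M', d') → (M, d)`, by means of the
homotopies `h'` and `h`. -/
structure IsHomotopyInverse (d' : M' →ₗ[k] M') (d : M →ₗ[k] M) (f : M' →ₗ[k] M)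
    (g : M →ₗ[k] M') (h' : M' →ₗ[k] M') (h : M →ₗ[k] M) : Prop where
  comm : ∀ x, d' (g x) = g (d x)
  left : ∀ x, d' (h' x) + h' (d' x) = x - g (f x)
  right : ∀ x, d (h x) + h (d x) = x - f (g x)

/-- The three maps are blocks of a contraction `s` of the cone, and the identities are the matrix
entries of `d s + s d = 1`. The block `M' → M'` changes sign because the cone carries `-d'` there.
-/
theorem IsQuasiIsoOf.exists_isHomotopyInverse {d' : M' →ₗ[k] M'} {d : M →ₗ[k] M} {f : M' →ₗ[k] M}
    {h : f ∘ₗ d' = d ∘ₗ f} (hd' : d' ∘ₗ d' = 0) (hd : d ∘ₗ d = 0) (hf : IsQuasiIsoOf d' d f h) :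
    ∃ g h' h, IsHomotopyInverse d' d f g h' h := by
  have e' : ∀ x, d' (d' x) = 0 := LinearMap.congr_fun hd'
  have e : ∀ x, d (d x) = 0 := LinearMap.congr_fun hd
  have hc : ∀ x, f (d' x) = d (f x) := LinearMap.congr_fun h
  obtain ⟨s, hs⟩ := exists_contraction (coneD d' d f) (fun x => by simp [e, e', hc])
    ((isQuasiIsoOf_iff_cone d' d f h).1 hf)
  refine ⟨LinearMap.fst k M' M ∘ₗ s ∘ₗ LinearMap.inr k M' M,
    -(LinearMap.fst k M' M ∘ₗ s ∘ₗ LinearMap.inl k M' M),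
    LinearMap.snd k M' M ∘ₗ s ∘ₗ LinearMap.inr k M' M, ⟨fun x => ?_, fun x => ?_, fun x => ?_⟩⟩
  · have := congrArg Prod.fst (hs (0, x))
    simp only [coneD_apply, Prod.fst_add, map_zero, neg_zero, zero_add] at this
    exact neg_add_eq_zero.1 this
  · have := congrArg Prod.fst (hs (x, 0))
    simp only [coneD_apply, Prod.fst_add, map_zero, add_zero] at this
    have h2 : ((-d' x, f x) : M' × M) = (0, f x) - (d' x, 0) := by simp
    rw [h2, map_sub, Prod.fst_sub] at this
    simp only [LinearMap.neg_apply, LinearMap.comp_apply, LinearMap.fst_apply,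
      LinearMap.inl_apply, LinearMap.inr_apply, map_neg]
    rw [eq_sub_iff_add_eq]
    nth_rewrite 4 [← this]
    abel
  · have := congrArg Prod.snd (hs (0, x))
    simp only [coneD_apply, Prod.snd_add, map_zero, neg_zero, zero_add] at this
    simp only [LinearMap.comp_apply, LinearMap.fst_apply, LinearMap.snd_apply,
      LinearMap.inr_apply]
    rw [eq_sub_iff_add_eq]
    nth_rewrite 4 [← this]
    abel

end HomotopyInverse

/-! ### Homogeneous parts of linear maps between graded bimodules. -/

section Homogeneous

variable {k S C C' ι : Type*} [Field k] [Ring S] [Algebra k S]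
  [AddCommGroup C] [Module k C] [Module S C] [Module Sᵐᵒᵖ C]
  [AddCommGroup C'] [Module k C'] [Module S C'] [Module Sᵐᵒᵖ C'] [DecidableEq ι]

namespace BimodGrading

theorem coeLinearMap_bijective (G : BimodGrading k S C ι) :
    Function.Bijective (DirectSum.coeLinearMap G.piece) := G.isInternal

/-- The projection to the component of degree `i`. -/
def component (G : BimodGrading k S C ι) (i : ι) : C →ₗ[k] C :=
  (G.piece i).subtype ∘ₗ DirectSum.component k ι (fun i => G.piece i) i ∘ₗ
    (LinearEquiv.ofBijective (DirectSum.coeLinearMap G.piece) G.coeLinearMap_bijective).symm.toLinearMap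

theorem symm_of_mem (G : BimodGrading k S C ι) {i : ι} {c : C} (hc : c ∈ G.piece i) :
    (LinearEquiv.ofBijective (DirectSum.coeLinearMap G.piece) G.coeLinearMap_bijective).symm c =
      DirectSum.lof k ι (fun i => G.piece i) i ⟨c, hc⟩ := by
  rw [LinearEquiv.symm_apply_eq, LinearEquiv.ofBijective_apply, DirectSum.lof_eq_of]
  exact (DirectSum.coeLinearMap_of G.piece i ⟨c, hc⟩).symm

theorem component_of_mem (G : BimodGrading k S C ι) {i : ι} {c : C} (hc : c ∈ G.piece i) :
    G.component i c = c := by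
  simp only [component, LinearMap.comp_apply, LinearEquiv.coe_coe]
  rw [G.symm_of_mem hc, DirectSum.component.lof_self]
  rfl

theorem component_of_mem_of_ne (G : BimodGrading k S C ι) {i j : ι} (hij : i ≠ j) {c : C}
    (hc : c ∈ G.piece i) : G.component j c = 0 := by
  simp only [component, LinearMap.comp_apply, LinearEquiv.coe_coe]
  rw [G.symm_of_mem hc, DirectSum.component.of, dif_neg hij]
  rfl

theorem component_mem (G : BimodGrading k S C ι) (i : ι) (c : C) : G.component i c ∈ G.piece i :=
  Subtype.property _

@[elab_as_elim]
theorem induction_on [Nonempty ι] (G : BimodGrading k S C ι) {P : C → Prop} (c : C)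
    (hmem : ∀ i, ∀ c ∈ G.piece i, P c) (hadd : ∀ x y, P x → P y → P (x + y)) : P c := by
  have hc : c ∈ ⨆ i, G.piece i := by rw [G.isInternal.submodule_iSup_eq_top]; trivial
  induction hc using Submodule.iSup_induction' with
  | mem i x hx => exact hmem i x hx
  | zero => exact hmem (Classical.arbitrary ι) 0 (zero_mem _)
  | add x y _ _ hx hy => exact hadd x y hx hy

/-- A map of degree `τ` commutes with the projections. -/
theorem component_map [Nonempty ι] (G : BimodGrading k S C ι) (G' : BimodGrading k S C' ι) (L : C →ₗ[k] C')
    {τ : ι → ι} (hτ : Function.Injective τ) (hL : ∀ i, ∀ c ∈ G.piece i, L c ∈ G'.piece (τ i))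
    (i : ι) (c : C) : G'.component (τ i) (L c) = L (G.component i c) := by
  refine G.induction_on c (fun j c hc => ?_) fun x y hx hy => by simp only [map_add, hx, hy]
  rcases eq_or_ne j i with rfl | hij
  · rw [G.component_of_mem hc, G'.component_of_mem (hL _ _ hc)]
  · rw [G.component_of_mem_of_ne hij hc, G'.component_of_mem_of_ne (hτ.ne hij) (hL _ _ hc), map_zero]

/-- The homogeneous part of degree `σ` of a linear map. -/
def homPart (G : BimodGrading k S C ι) (G' : BimodGrading k S C' ι) (σ : ι → ι)
    (L : C →ₗ[k] C') : C →ₗ[k] C' :=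
  (DirectSum.toModule k ι C' fun i => G'.component (σ i) ∘ₗ L ∘ₗ (G.piece i).subtype) ∘ₗ
    (LinearEquiv.ofBijective (DirectSum.coeLinearMap G.piece) G.coeLinearMap_bijective).symm.toLinearMap

theorem homPart_of_mem (G : BimodGrading k S C ι) (G' : BimodGrading k S C' ι) (σ : ι → ι)
    (L : C →ₗ[k] C') {i : ι} {c : C} (hc : c ∈ G.piece i) :
    G.homPart G' σ L c = G'.component (σ i) (L c) := by
  rw [homPart, LinearMap.comp_apply, LinearEquiv.coe_coe, G.symm_of_mem hc, DirectSum.toModule_lof]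
  rfl

theorem homPart_mem (G : BimodGrading k S C ι) (G' : BimodGrading k S C' ι) (σ : ι → ι)
    (L : C →ₗ[k] C') (i : ι) (c : C) (hc : c ∈ G.piece i) :
    G.homPart G' σ L c ∈ G'.piece (σ i) := by
  rw [G.homPart_of_mem G' σ L hc]
  exact G'.component_mem _ _

/-- The projections of `G` preserve a submodule that is the sum of its homogeneous parts. -/
theorem component_mem_of_le (G : BimodGrading k S C ι) {V : Submodule k C}
    (hV : V ≤ ⨆ n, V ⊓ G.piece n) (n : ι) {c : C} (hc : c ∈ V) : G.component n c ∈ V := by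
  replace hc := hV hc
  induction hc using Submodule.iSup_induction' with
  | mem i x hx =>
    rcases eq_or_ne i n with rfl | hin
    · rw [G.component_of_mem hx.2]; exact hx.1
    · rw [G.component_of_mem_of_ne hin hx.2]; exact zero_mem _
  | zero => simp
  | add x y _ _ hx hy => rw [map_add]; exact add_mem hx hy

/-- This allows homogeneous parts for a second grading to be taken without losing compatibility with
the first. -/
theorem homPart_mem_of_le (G : BimodGrading k S C ι) (G' : BimodGrading k S C' ι) (σ : ι → ι)
    (L : C →ₗ[k] C') {V : Submodule k C} {V' : Submodule k C'}
    (hV : V ≤ ⨆ n, V ⊓ G.piece n) (hV' : V' ≤ ⨆ n, V' ⊓ G'.piece n)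
    (hL : ∀ c ∈ V, L c ∈ V') (c : C) (hc : c ∈ V) : G.homPart G' σ L c ∈ V' := by
  replace hc := hV hc
  induction hc using Submodule.iSup_induction' with
  | mem i x hx =>
    rw [G.homPart_of_mem G' σ L hx.2]
    exact G'.component_mem_of_le hV' _ (hL _ hx.1)
  | zero => simp
  | add x y _ _ hx hy => rw [map_add]; exact add_mem hx hy

end BimodGrading

/-- A homotopy inverse of a map that preserves degrees may be replaced by its homogeneous part. -/
theorem IsHomotopyInverse.homPart [Nonempty ι] {d' : C' →ₗ[k] C'} {d : C →ₗ[k] C} {f : C' →ₗ[k] C}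
    {g : C →ₗ[k] C'} {h' : C' →ₗ[k] C'} {h : C →ₗ[k] C} (H : IsHomotopyInverse d' d f g h' h)
    (G' : BimodGrading k S C' ι) (G : BimodGrading k S C ι) (τ σ : ι → ι)
    (hστ : ∀ i, σ (τ i) = i) (hτσ : ∀ i, τ (σ i) = i)
    (hd' : ∀ i, ∀ c ∈ G'.piece i, d' c ∈ G'.piece (τ i))
    (hd : ∀ i, ∀ c ∈ G.piece i, d c ∈ G.piece (τ i))
    (hf : ∀ i, ∀ c ∈ G'.piece i, f c ∈ G.piece i) :
    IsHomotopyInverse d' d f (G.homPart G' id g) (G'.homPart G' σ h') (G.homPart G σ h) := by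
  have hτ : Function.Injective τ := Function.LeftInverse.injective hστ
  refine ⟨fun x => ?_, fun x => ?_, fun x => ?_⟩
  · refine G.induction_on x (fun i c hc => ?_) fun x y hx hy => by simp only [map_add, hx, hy]
    rw [G.homPart_of_mem _ _ _ hc, G.homPart_of_mem _ _ _ (hd _ _ hc), id, id,
      ← G'.component_map G' d' hτ hd', H.comm]
  · refine G'.induction_on x (fun i c hc => ?_) fun x y hx hy => by
      simp only [map_add]; rw [add_add_add_comm, hx, hy]; abel
    -- For `c` of degree `i`, take the degree `i` component of the homotopy identity. As `d'` shifts
    -- degrees by `τ` and the new homotopy by its inverse `σ`, both composites return to degree `i`.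
    have := congrArg (G'.component i) (H.left c)
    rw [map_add, map_sub, G'.component_of_mem hc] at this
    rw [G'.homPart_of_mem _ _ _ hc, G'.homPart_of_mem _ _ _ (hd' _ _ hc),
      ← G'.component_map G' d' hτ hd', hτσ, hστ, G.homPart_of_mem _ _ _ (hf _ _ hc), this, id]
  · refine G.induction_on x (fun i c hc => ?_) fun x y hx hy => by
      simp only [map_add]; rw [add_add_add_comm, hx, hy]; abel
    have := congrArg (G.component i) (H.right c)
    rw [map_add, map_sub, G.component_of_mem hc] at this
    rw [G.homPart_of_mem _ _ _ hc, G.homPart_of_mem _ _ _ (hd _ _ hc),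
      ← G.component_map G d hτ hd, hτσ, hστ, G.homPart_of_mem _ _ _ hc, this,
      ← G'.component_map G f Function.injective_id hf, id, id]

end Homogeneous

/-! ### Averaging linear maps over a separability idempotent. -/

section Averaging

variable {k S C C' : Type*} [Field k] [Ring S] [Algebra k S]
  [AddCommGroup C] [Module k C] [Module S C] [Module Sᵐᵒᵖ C]
  [AddCommGroup C'] [Module k C'] [Module S C'] [Module Sᵐᵒᵖ C']

variable (k S) in
/-- The multiplication `S ⊗ Sᵐᵒᵖ → S`. -/
def envelopingMul : S ⊗[k] Sᵐᵒᵖ →ₗ[k] S :=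
  TensorProduct.lift (LinearMap.mk₂ k (fun (a : S) (b : Sᵐᵒᵖ) => a * b.unop)
    (fun _ _ _ => add_mul _ _ _) (fun _ _ _ => smul_mul_assoc _ _ _)
    (fun _ _ _ => mul_add _ _ _) (fun _ _ _ => mul_smul_comm _ _ _))

@[simp] theorem envelopingMul_tmul (a : S) (b : Sᵐᵒᵖ) :
    envelopingMul k S (a ⊗ₜ b) = a * b.unop := rfl

/-- A separable algebra has a separability idempotent. -/
theorem IsSeparableAlg.exists_idempotent (hS : IsSeparableAlg k S) :
    ∃ e : S ⊗[k] Sᵐᵒᵖ, envelopingMul k S e = 1 ∧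
      ∀ s : S, (s ⊗ₜ 1) * e = (1 ⊗ₜ MulOpposite.op s) * e := by
  let _ : Module (S ⊗[k] Sᵐᵒᵖ) S := TensorProduct.Algebra.module
  have : Module.Projective (S ⊗[k] Sᵐᵒᵖ) S := hS
  have hmul : ∀ t : S ⊗[k] Sᵐᵒᵖ, t • (1 : S) = envelopingMul k S t := fun t => by
    induction t using TensorProduct.induction_on with
    | zero => exact (zero_smul (S ⊗[k] Sᵐᵒᵖ) (1 : S)).trans (map_zero _).symm
    | tmul a b =>
      rw [TensorProduct.Algebra.smul_def, envelopingMul_tmul]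
      change a * (1 * b.unop) = _
      rw [one_mul]
    | add x y hx hy => rw [add_smul, map_add, hx, hy]
  -- Projectivity splits the surjection `t ↦ t • 1` by an `S ⊗ Sᵐᵒᵖ`-linear map `σ`. The idempotent
  -- is `σ 1`; since `s ⊗ 1` and `1 ⊗ op s` both send `1` to `s`, their products with it both equal
  -- `σ s`.
  obtain ⟨σ, hσ⟩ := Module.projective_lifting_property
    (LinearMap.toSpanSingleton (S ⊗[k] Sᵐᵒᵖ) S 1) LinearMap.id
    (fun s => ⟨s ⊗ₜ 1, by simp [hmul]⟩)
  refine ⟨σ 1, ?_, fun s => ?_⟩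
  · rw [← hmul]
    exact LinearMap.congr_fun hσ 1
  · rw [← smul_eq_mul, ← smul_eq_mul, ← map_smul, ← map_smul, hmul, hmul]
    simp

variable [IsScalarTower k S C] [IsScalarTower k Sᵐᵒᵖ C]
  [IsScalarTower k S C'] [IsScalarTower k Sᵐᵒᵖ C']

/-- The average `x ↦ ∑ aᵢ L(bᵢ x)` over `t = ∑ aᵢ ⊗ bᵢ`. -/
def leftAvg (L : C →ₗ[k] C') : S ⊗[k] Sᵐᵒᵖ →ₗ[k] C →ₗ[k] C' :=
  TensorProduct.lift (LinearMap.mk₂ k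
    (fun (a : S) (b : Sᵐᵒᵖ) => Algebra.lsmul k k C' a ∘ₗ L ∘ₗ Algebra.lsmul k k C b.unop)
    (fun a a' b => by ext; simp) (fun r a b => by ext; simp)
    (fun a b b' => by ext; simp) (fun r a b => by ext; simp [smul_comm a r]))

/-- The average `x ↦ ∑ L(x aᵢ) bᵢ` over `t = ∑ aᵢ ⊗ bᵢ`. -/
def rightAvg (L : C →ₗ[k] C') : S ⊗[k] Sᵐᵒᵖ →ₗ[k] C →ₗ[k] C' :=
  TensorProduct.lift (LinearMap.mk₂ k
    (fun (a : S) (b : Sᵐᵒᵖ) =>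
      Algebra.lsmul k k C' b ∘ₗ L ∘ₗ Algebra.lsmul k k C (MulOpposite.op a))
    (fun a a' b => by ext; simp) (fun r a b => by ext; simp [smul_comm b r])
    (fun a b b' => by ext; simp) (fun r a b => by ext; simp))

@[simp] theorem leftAvg_tmul (L : C →ₗ[k] C') (a : S) (b : Sᵐᵒᵖ) (x : C) :
    leftAvg L (a ⊗ₜ b) x = a • L (b.unop • x) := rfl

@[simp] theorem rightAvg_tmul (L : C →ₗ[k] C') (a : S) (b : Sᵐᵒᵖ) (x : C) :
    rightAvg L (a ⊗ₜ b) x = b • L (MulOpposite.op a • x) := rfl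

/-- This formula and the next three turn the action of `S` before or after averaging into
multiplication on the averaging element. The idempotent equation then says exactly that the left
average is left linear and the right average is right linear. -/
theorem smul_leftAvg (L : C →ₗ[k] C') (s : S) (t : S ⊗[k] Sᵐᵒᵖ) (x : C) :
    s • leftAvg L t x = leftAvg L ((s ⊗ₜ 1) * t) x := by
  induction t using TensorProduct.induction_on with
  | zero => simp
  | tmul a b => simp [mul_smul]
  | add t u ht hu => simp only [map_add, mul_add, LinearMap.add_apply, smul_add, ht, hu]

theorem leftAvg_smul (L : C →ₗ[k] C') (s : S) (t : S ⊗[k] Sᵐᵒᵖ) (x : C) :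
    leftAvg L t (s • x) = leftAvg L ((1 ⊗ₜ MulOpposite.op s) * t) x := by
  induction t using TensorProduct.induction_on with
  | zero => simp
  | tmul a b => simp [mul_smul]
  | add t u ht hu => simp only [map_add, mul_add, LinearMap.add_apply, ht, hu]

theorem rightAvg_op_smul (L : C →ₗ[k] C') (s : S) (t : S ⊗[k] Sᵐᵒᵖ) (x : C) :
    rightAvg L t (MulOpposite.op s • x) = rightAvg L ((s ⊗ₜ 1) * t) x := by
  induction t using TensorProduct.induction_on with
  | zero => simp
  | tmul a b => simp [mul_smul]
  | add t u ht hu => simp only [map_add, mul_add, LinearMap.add_apply, ht, hu]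

theorem op_smul_rightAvg (L : C →ₗ[k] C') (s : S) (t : S ⊗[k] Sᵐᵒᵖ) (x : C) :
    MulOpposite.op s • rightAvg L t x = rightAvg L ((1 ⊗ₜ MulOpposite.op s) * t) x := by
  induction t using TensorProduct.induction_on with
  | zero => simp
  | tmul a b => simp [mul_smul]
  | add t u ht hu => simp only [map_add, mul_add, LinearMap.add_apply, smul_add, ht, hu]

variable [SMulCommClass S Sᵐᵒᵖ C] [SMulCommClass S Sᵐᵒᵖ C']

/-- The average of a linear map of bimodules over an element of the enveloping algebra, on both
sides. -/
def bimodAvg (t : S ⊗[k] Sᵐᵒᵖ) (L : C →ₗ[k] C') : C →ₗ[k] C' := rightAvg (leftAvg L t) t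

/-- The inner average is already left linear by `he`. The outer one adds only right multiplications,
which commute with the left action. -/
theorem bimodAvg_smul {e : S ⊗[k] Sᵐᵒᵖ} (he : ∀ s : S, (s ⊗ₜ 1) * e = (1 ⊗ₜ MulOpposite.op s) * e)
    (L : C →ₗ[k] C') (s : S) (x : C) : bimodAvg e L (s • x) = s • bimodAvg e L x := by
  have key : ∀ y, leftAvg L e (s • y) = s • leftAvg L e y := fun y => by
    rw [leftAvg_smul, smul_leftAvg, he]
  rw [bimodAvg]
  -- The induction must expand only the outer copy of `e`: neither `he` nor the linearity of the
  -- inner average holds for the separate summands of `e`.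
  generalize leftAvg L e = M at key
  clear he
  induction e using TensorProduct.induction_on with
  | zero => simp
  | tmul a b => rw [rightAvg_tmul, rightAvg_tmul, ← smul_comm s, key, smul_comm s b]
  | add t u ht hu => simp only [map_add, LinearMap.add_apply, smul_add, ht, hu]

theorem bimodAvg_op_smul {e : S ⊗[k] Sᵐᵒᵖ}
    (he : ∀ s : S, (s ⊗ₜ 1) * e = (1 ⊗ₜ MulOpposite.op s) * e)
    (L : C →ₗ[k] C') (s : S) (x : C) :
    bimodAvg e L (MulOpposite.op s • x) = MulOpposite.op s • bimodAvg e L x := by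
  rw [bimodAvg, rightAvg_op_smul, op_smul_rightAvg, he]

theorem bimodAvg_id {e : S ⊗[k] Sᵐᵒᵖ} (he : envelopingMul k S e = 1) :
    bimodAvg e (LinearMap.id : C →ₗ[k] C) = LinearMap.id := by
  have hl : ∀ (t : S ⊗[k] Sᵐᵒᵖ) (x : C), leftAvg LinearMap.id t x = envelopingMul k S t • x :=
    fun t x => by
      induction t using TensorProduct.induction_on with
      | zero => simp
      | tmul a b => simp [mul_smul]
      | add t u ht hu => simp only [map_add, LinearMap.add_apply, add_smul, ht, hu]
  have hr : ∀ (t : S ⊗[k] Sᵐᵒᵖ) (x : C),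
      rightAvg LinearMap.id t x = MulOpposite.op (envelopingMul k S t) • x := fun t x => by
    induction t using TensorProduct.induction_on with
    | zero => simp
    | tmul a b => simp [mul_smul]
    | add t u ht hu =>
      simp only [map_add, LinearMap.add_apply, add_smul, ht, hu, MulOpposite.op_add]
  have : leftAvg (LinearMap.id : C →ₗ[k] C) e = LinearMap.id := by ext x; simp [hl, he]
  rw [bimodAvg, this]
  ext x
  simp [hr, he]

theorem bimodAvg_mem (t : S ⊗[k] Sᵐᵒᵖ) {ι : Type*} [DecidableEq ι] (G : BimodGrading k S C ι)
    (G' : BimodGrading k S C' ι) {i j : ι} (L : C →ₗ[k] C')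
    (hL : ∀ c ∈ G.piece i, L c ∈ G'.piece j) : ∀ c ∈ G.piece i, bimodAvg t L c ∈ G'.piece j := by
  have hl : ∀ u : S ⊗[k] Sᵐᵒᵖ, ∀ c ∈ G.piece i, leftAvg L u c ∈ G'.piece j := fun u c hc => by
    induction u using TensorProduct.induction_on with
    | zero => simp
    | tmul a b => exact G'.smul_mem _ _ _ (hL _ (G.smul_mem _ _ _ hc))
    | add t u ht hu => rw [map_add]; exact add_mem ht hu
  unfold bimodAvg
  have hM := hl t
  generalize leftAvg L t = M at hM
  intro c hc
  induction t using TensorProduct.induction_on with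
  | zero => simp
  | tmul a b => exact G'.op_smul_mem _ b.unop _ (hM _ (G.op_smul_mem _ _ _ hc))
  | add t u ht hu => rw [map_add]; exact add_mem ht hu

theorem bimodAvg_add (t : S ⊗[k] Sᵐᵒᵖ) (L M : C →ₗ[k] C') :
    bimodAvg t (L + M) = bimodAvg t L + bimodAvg t M := by
  have hl : ∀ u : S ⊗[k] Sᵐᵒᵖ, leftAvg (L + M) u = leftAvg L u + leftAvg M u := fun u => by
    induction u using TensorProduct.induction_on with
    | zero => simp
    | tmul a b => ext; simp
    | add t u ht hu => simp only [map_add, ht, hu]; abel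
  unfold bimodAvg
  rw [hl]
  generalize leftAvg L t = L
  generalize leftAvg M t = M
  induction t using TensorProduct.induction_on with
  | zero => simp
  | tmul a b => ext; simp
  | add t u ht hu => simp only [map_add, ht, hu]; abel

variable {C'' : Type*} [AddCommGroup C''] [Module k C''] [Module S C''] [Module Sᵐᵒᵖ C'']
  [IsScalarTower k S C''] [IsScalarTower k Sᵐᵒᵖ C''] [SMulCommClass S Sᵐᵒᵖ C'']

/-- Together with `bimodAvg_comp` and `bimodAvg_add`, this lets the homotopy identities be averaged
term by term. -/
theorem comp_bimodAvg (t : S ⊗[k] Sᵐᵒᵖ) (L : C →ₗ[k] C') (A : C' →ₗ[k] C'')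
    (hl : ∀ (s : S) c, A (s • c) = s • A c)
    (hr : ∀ (s : S) c, A (MulOpposite.op s • c) = MulOpposite.op s • A c) :
    bimodAvg t (A ∘ₗ L) = A ∘ₗ bimodAvg t L := by
  have hl : ∀ u : S ⊗[k] Sᵐᵒᵖ, leftAvg (A ∘ₗ L) u = A ∘ₗ leftAvg L u := fun u => by
    induction u using TensorProduct.induction_on with
    | zero => simp
    | tmul a b => ext; simp [hl]
    | add t u ht hu => simp only [map_add, ht, hu, LinearMap.comp_add]
  unfold bimodAvg
  rw [hl]
  generalize leftAvg L t = L
  induction t using TensorProduct.induction_on with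
  | zero => simp
  | tmul a b => ext x; exact (hr b.unop _).symm
  | add t u ht hu => simp only [map_add, ht, hu, LinearMap.comp_add]

theorem bimodAvg_comp (t : S ⊗[k] Sᵐᵒᵖ) (L : C' →ₗ[k] C'') (A : C →ₗ[k] C')
    (hl : ∀ (s : S) c, A (s • c) = s • A c)
    (hr : ∀ (s : S) c, A (MulOpposite.op s • c) = MulOpposite.op s • A c) :
    bimodAvg t (L ∘ₗ A) = bimodAvg t L ∘ₗ A := by
  have hl : ∀ u : S ⊗[k] Sᵐᵒᵖ, leftAvg (L ∘ₗ A) u = leftAvg L u ∘ₗ A := fun u => by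
    induction u using TensorProduct.induction_on with
    | zero => simp
    | tmul a b => ext; simp [hl]
    | add t u ht hu => simp only [map_add, ht, hu, LinearMap.add_comp]
  unfold bimodAvg
  rw [hl]
  generalize leftAvg L t = L
  induction t using TensorProduct.induction_on with
  | zero => simp
  | tmul a b => ext x; simp [hr]
  | add t u ht hu => simp only [map_add, ht, hu, LinearMap.add_comp]

/-- A homotopy inverse of a map of complexes of bimodules over a separable algebra may be averaged
to one that consists of homomorphisms of bimodules. -/
theorem IsHomotopyInverse.bimodAvg {d' : C' →ₗ[k] C'} {d : C →ₗ[k] C} {f : C' →ₗ[k] C}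
    {g : C →ₗ[k] C'} {h' : C' →ₗ[k] C'} {h : C →ₗ[k] C} (H : IsHomotopyInverse d' d f g h' h)
    {e : S ⊗[k] Sᵐᵒᵖ} (he : envelopingMul k S e = 1)
    (hdl' : ∀ (s : S) c, d' (s • c) = s • d' c)
    (hdr' : ∀ (s : S) c, d' (MulOpposite.op s • c) = MulOpposite.op s • d' c)
    (hdl : ∀ (s : S) c, d (s • c) = s • d c)
    (hdr : ∀ (s : S) c, d (MulOpposite.op s • c) = MulOpposite.op s • d c)
    (hfl : ∀ (s : S) c, f (s • c) = s • f c)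
    (hfr : ∀ (s : S) c, f (MulOpposite.op s • c) = MulOpposite.op s • f c) :
    IsHomotopyInverse d' d f (bimodAvg e g) (bimodAvg e h') (bimodAvg e h) := by
  have h1 : d' ∘ₗ g = g ∘ₗ d := LinearMap.ext H.comm
  have h2 : d' ∘ₗ h' + h' ∘ₗ d' + g ∘ₗ f = LinearMap.id := LinearMap.ext fun x => by
    simp [H.left]
  have h3 : d ∘ₗ h + h ∘ₗ d + f ∘ₗ g = LinearMap.id := LinearMap.ext fun x => by
    simp [H.right]
  refine ⟨fun x => ?_, fun x => ?_, fun x => ?_⟩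
  · have := congrArg (_root_.bimodAvg e) h1
    rw [comp_bimodAvg e _ _ hdl' hdr', bimodAvg_comp e _ _ hdl hdr] at this
    exact LinearMap.congr_fun this x
  · have := congrArg (_root_.bimodAvg e) h2
    rw [bimodAvg_add, bimodAvg_add, comp_bimodAvg e _ _ hdl' hdr', bimodAvg_comp e _ _ hdl' hdr',
      bimodAvg_comp e _ _ hfl hfr, bimodAvg_id he] at this
    exact eq_sub_iff_add_eq.2 (LinearMap.congr_fun this x)
  · have := congrArg (_root_.bimodAvg e) h3
    rw [bimodAvg_add, bimodAvg_add, comp_bimodAvg e _ _ hdl hdr, bimodAvg_comp e _ _ hdl hdr,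
      comp_bimodAvg e _ _ hfl hfr, bimodAvg_id he] at this
    exact eq_sub_iff_add_eq.2 (LinearMap.congr_fun this x)

end Averaging

/-! ### Contractions up to a locally nilpotent error. -/

section Perturbation

variable {k : Type*} [Field k] {M M' : Type*} [AddCommGroup M] [Module k M] [AddCommGroup M']
  [Module k M']

/-- A complex that is contractible up to a locally nilpotent perturbation is acyclic. -/
theorem acyclic_of_locally_nilpotent (d h N : M →ₗ[k] M) (hd : ∀ x, d (d x) = 0)
    (hN : ∀ x, d (h x) + h (d x) = x + N x) (hnil : ∀ x, ∃ m, (N ^ m) x = 0) (x : M)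
    (hx : d x = 0) : ∃ y, d y = x := by
  obtain ⟨m, hm⟩ := hnil x
  induction m generalizing x with
  | zero => exact ⟨0, by simpa using hm.symm⟩
  | succ m ih =>
    -- For a cycle, `x = d (h x) - N x`, and `N x` is again a cycle, killed by one power of `N`
    -- fewer.
    have h1 := hN x
    rw [hx, map_zero, add_zero] at h1
    have h2 : d (N x) = 0 := by
      have := hd (h x)
      rwa [h1, map_add, hx, zero_add] at this
    obtain ⟨y, hy⟩ := ih (N x) h2 (by rwa [pow_succ] at hm)
    exact ⟨h x - y, by rw [map_sub, hy, h1, add_sub_cancel_right]⟩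

/-- A map of filtered complexes with a homotopy inverse up to terms that raise the filtration has an
acyclic cone. -/
theorem cone_acyclic_of_filtered (D' : M' →ₗ[k] M') (D : M →ₗ[k] M) (Φ : M' →ₗ[k] M)
    (hD' : ∀ x, D' (D' x) = 0) (hD : ∀ x, D (D x) = 0) (hΦ : ∀ x, Φ (D' x) = D (Φ x))
    (U : M →ₗ[k] M') (K' : M' →ₗ[k] M') (K : M →ₗ[k] M)
    (A' : ℕ → ℕ → Submodule k M') (A : ℕ → ℕ → Submodule k M)
    (htop' : ⨆ w, A' 0 w = ⊤) (htop : ⨆ w, A 0 w = ⊤)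
    (hbot' : ∀ w, A' (w + 1) w = ⊥) (hbot : ∀ w, A (w + 1) w = ⊥)
    (hanti' : ∀ p w, A' (p + 1) w ≤ A' p w) (hanti : ∀ p w, A (p + 1) w ≤ A p w)
    (hleft : ∀ p w, ∀ x ∈ A' p w, U (Φ x) - (D' (K' x) + K' (D' x)) - x ∈ A' (p + 1) w)
    (hU : ∀ p w, ∀ x ∈ A p w, U (D x) - D' (U x) ∈ A' (p + 1) w)
    (hright : ∀ p w, ∀ x ∈ A p w, Φ (U x) - (D (K x) + K (D x)) - x ∈ A (p + 1) w)
    (hK : ∀ p w, ∀ x ∈ A' p w, Φ (K' x) - K (Φ x) ∈ A p w)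
    (x : M' × M) (hx : coneD D' D Φ x = 0) : ∃ y, coneD D' D Φ y = x := by
  set d := coneD D' D Φ with hd
  -- The sign of `K` matches the convention `D K + K D ≈ Φ U - 1`. On `M'` the same sign comes from
  -- the entry `-D'` of the cone differential.
  set h : M' × M →ₗ[k] M' × M := (K'.coprod U).prod (-(K ∘ₗ LinearMap.snd k M' M)) with hh
  set N : M' × M →ₗ[k] M' × M := d ∘ₗ h + h ∘ₗ d - LinearMap.id with hN
  have hN1 : ∀ z, (N z).1 = (U (D z.2) - D' (U z.2)) +
      (U (Φ z.1) - (D' (K' z.1) + K' (D' z.1)) - z.1) := fun z => by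
    simp [hN, hh, hd]; abel
  have hN2 : ∀ z, (N z).2 = (Φ (U z.2) - (D (K z.2) + K (D z.2)) - z.2) +
      (Φ (K' z.1) - K (Φ z.1)) := fun z => by
    simp [hN, hh, hd]; abel
  refine acyclic_of_locally_nilpotent d h N (fun z => ?_) (fun z => ?_) (fun z => ?_) x hx
  · simp [hd, hD, hD', hΦ]
  · simp [hN]
  -- Three entries of `N` raise the filtration; the entry `Φ K' - K Φ` from `M'` to `M` merely
  -- preserves it. Two consecutive factors cannot both be that entry, so `N ^ 2` raises the
  -- filtration.
  · have step : ∀ p w (z : M' × M), z.1 ∈ A' p w → z.2 ∈ A p w →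
        ((N ^ 2) z).1 ∈ A' (p + 1) w ∧ ((N ^ 2) z).2 ∈ A (p + 1) w := fun p w z h1 h2 => by
      have e1 : (N z).1 ∈ A' (p + 1) w := by
        rw [hN1]; exact add_mem (hU _ _ _ h2) (hleft _ _ _ h1)
      have e2 : (N z).2 ∈ A p w := by
        rw [hN2]; exact add_mem (hanti _ _ (hright _ _ _ h2)) (hK _ _ _ h1)
      rw [pow_two, Module.End.mul_apply]
      constructor
      · rw [hN1]; exact add_mem (hU _ _ _ e2) (hanti' _ _ (hleft _ _ _ e1))
      · rw [hN2]; exact add_mem (hright _ _ _ e2) (hK _ _ _ e1)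
    have steps : ∀ w (z : M' × M), z.1 ∈ A' 0 w → z.2 ∈ A 0 w → ∀ p,
        ((N ^ (2 * p)) z).1 ∈ A' p w ∧ ((N ^ (2 * p)) z).2 ∈ A p w := fun w z h1 h2 p => by
      induction p with
      | zero => exact ⟨h1, h2⟩
      | succ p ih =>
        rw [mul_add, mul_one, add_comm (2 * p), pow_add]
        exact step p w _ ih.1 ih.2
    have hom : ∀ w (z : M' × M), z.1 ∈ A' 0 w → z.2 ∈ A 0 w → ∃ m, (N ^ m) z = 0 :=
      fun w z h1 h2 => by
        -- In degree `w` the filtration vanishes at step `w + 1`, so `N ^ (2 * (w + 1))` is zero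
        -- there.
        have := steps w z h1 h2 (w + 1)
        rw [hbot, hbot', Submodule.mem_bot, Submodule.mem_bot] at this
        exact ⟨_, Prod.ext this.1 this.2⟩
    have hadd : ∀ y z : M' × M, (∃ m, (N ^ m) y = 0) → (∃ m, (N ^ m) z = 0) →
        ∃ m, (N ^ m) (y + z) = 0 := by
      rintro y z ⟨m, hm⟩ ⟨n, hn⟩
      refine ⟨m + n, ?_⟩
      rw [map_add]
      nth_rewrite 1 [add_comm m n]
      rw [pow_add, pow_add, Module.End.mul_apply, Module.End.mul_apply, hm, hn, map_zero, map_zero,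
        add_zero]
    have h1 : ∀ y : M', ∃ m, (N ^ m) (y, 0) = 0 := fun y => by
      have hy : y ∈ ⨆ w, A' 0 w := by rw [htop']; trivial
      induction hy using Submodule.iSup_induction' with
      | mem w y hy => exact hom w _ hy (zero_mem _)
      | zero => exact ⟨0, rfl⟩
      | add y z _ _ hy hz => simpa using hadd _ _ hy hz
    have h2 : ∀ y : M, ∃ m, (N ^ m) (0, y) = 0 := fun y => by
      have hy : y ∈ ⨆ w, A 0 w := by rw [htop]; trivial
      induction hy using Submodule.iSup_induction' with
      | mem w y hy => exact hom w _ (zero_mem _) hy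
      | zero => exact ⟨0, rfl⟩
      | add y z _ _ hy hz => simpa using hadd _ _ hy hz
    simpa using hadd _ _ (h1 z.1) (h2 z.2)

end Perturbation

/-! ### The filtration by tensor length, and twisted derivations. -/

section LengthFiltration

variable {k S C C' : Type*} [Field k] [Ring S] [Algebra k S]
  [AddCommGroup C] [Module k C] [Module S C] [Module Sᵐᵒᵖ C] [IsScalarTower k S C]
  [AddCommGroup C'] [Module k C'] [Module S C'] [Module Sᵐᵒᵖ C'] [IsScalarTower k S C']

namespace BimodGrading

/-- `IsWord G n w x` says that `x` is a product of `n` homogeneous elements of `C`, of total degree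
`w`, and of an element of `S`. -/
inductive IsWord (G : BimodGrading k S C ℕ) : ℕ → ℕ → BimodTensor k S C → Prop
  | inS (s : S) : IsWord G 0 0 (inS k S C s)
  | cons {i n w : ℕ} {c : C} {x : BimodTensor k S C} (hc : c ∈ G.piece i) (hx : IsWord G n w x) :
      IsWord G (n + 1) (i + w) (inC k S C c * x)

/-- The elements of the tensor algebra of degree `w` and tensor length at least `p`. -/
def lengthFiltration (G : BimodGrading k S C ℕ) (p w : ℕ) : Submodule k (BimodTensor k S C) :=
  Submodule.span k {x | ∃ n, p ≤ n ∧ G.IsWord n w x}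

variable (G : BimodGrading k S C ℕ) {G' : BimodGrading k S C' ℕ}

theorem IsWord.mem {G : BimodGrading k S C ℕ} {n w : ℕ} {x : BimodTensor k S C}
    (h : G.IsWord n w x) : x ∈ G.lengthFiltration n w :=
  Submodule.subset_span ⟨n, le_rfl, h⟩

theorem lengthFiltration_anti {p q : ℕ} (h : p ≤ q) (w : ℕ) :
    G.lengthFiltration q w ≤ G.lengthFiltration p w :=
  Submodule.span_mono fun _ ⟨n, hn, hx⟩ => ⟨n, h.trans hn, hx⟩

/-- The first letter absorbs a scalar on its left. Hence one scalar at the end of a word suffices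
for words to be closed under products. -/
theorem IsWord.inS_mul {G : BimodGrading k S C ℕ} {n w : ℕ} {x : BimodTensor k S C}
    (h : G.IsWord n w x) (s : S) : G.IsWord n w (BimodTensor.inS k S C s * x) := by
  cases h with
  | inS t => rw [← map_mul]; exact IsWord.inS _
  | cons hc hx =>
    rw [← mul_assoc, ← inC_smul]
    exact IsWord.cons (G.smul_mem _ _ _ hc) hx

theorem IsWord.mul {G : BimodGrading k S C ℕ} {n m w v : ℕ} {x y : BimodTensor k S C}
    (hx : G.IsWord n w x) (hy : G.IsWord m v y) : G.IsWord (n + m) (w + v) (x * y) := by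
  induction hx with
  | inS s => rw [zero_add, zero_add]; exact hy.inS_mul s
  | @cons i n w c x hc _ ih =>
    rw [mul_assoc, add_assoc i, add_right_comm n]
    exact IsWord.cons hc ih

theorem mul_mem_lengthFiltration {p q w v : ℕ} {x y : BimodTensor k S C}
    (hx : x ∈ G.lengthFiltration p w) (hy : y ∈ G.lengthFiltration q v) :
    x * y ∈ G.lengthFiltration (p + q) (w + v) := by
  induction hx using Submodule.span_induction with
  | mem x hx =>
    obtain ⟨n, hn, hx⟩ := hx
    induction hy using Submodule.span_induction with
    | mem y hy =>
      obtain ⟨m, hm, hy⟩ := hy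
      exact Submodule.subset_span ⟨n + m, add_le_add hn hm, hx.mul hy⟩
    | zero => simp
    | add a b _ _ ha hb => rw [mul_add]; exact add_mem ha hb
    | smul r a _ ha => rw [mul_smul_comm]; exact Submodule.smul_mem _ _ ha
  | zero => simp
  | add a b _ _ ha hb => rw [add_mul]; exact add_mem ha hb
  | smul r a _ ha => rw [smul_mul_assoc]; exact Submodule.smul_mem _ _ ha

theorem inS_mem_lengthFiltration (s : S) : inS k S C s ∈ G.lengthFiltration 0 0 :=
  (IsWord.inS s).mem

theorem inC_mem_lengthFiltration {i : ℕ} {c : C} (hc : c ∈ G.piece i) :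
    inC k S C c ∈ G.lengthFiltration 1 i := by
  have := (IsWord.cons hc (IsWord.inS (G := G) 1)).mem
  simpa using this

theorem iSup_lengthFiltration : ⨆ w, G.lengthFiltration 0 w = ⊤ := by
  rw [eq_top_iff]
  rintro x -
  induction x using BimodTensor.induction with
  | hS s => exact Submodule.mem_iSup_of_mem 0 (G.inS_mem_lengthFiltration s)
  | hC c =>
    refine G.induction_on c (fun i c hc => ?_) fun x y hx hy => by rw [map_add]; exact add_mem hx hy
    exact Submodule.mem_iSup_of_mem i
      (G.lengthFiltration_anti zero_le_one i (G.inC_mem_lengthFiltration hc))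
  | hadd x y hx hy => exact add_mem hx hy
  | hmul x y hx hy =>
    induction hx using Submodule.iSup_induction' with
    | mem w x hx =>
      induction hy using Submodule.iSup_induction' with
      | mem v y hy =>
        have h := G.mul_mem_lengthFiltration hx hy
        rw [add_zero] at h
        exact Submodule.mem_iSup_of_mem (w + v) h
      | zero => simp
      | add a b _ _ ha hb => rw [mul_add]; exact add_mem ha hb
    | zero => simp
    | add a b _ _ ha hb => rw [add_mul]; exact add_mem ha hb

variable {G} in
-- If every letter has degree at least `1`, the degree is at least the length; otherwise some letter
-- lies in the zero piece. This is where strict positivity of the grading enters.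
theorem IsWord.eq_zero (h0 : G.piece 0 = ⊥) {n w : ℕ} {x : BimodTensor k S C}
    (hx : G.IsWord n w x) (hw : w < n) : x = 0 := by
  induction hx with
  | inS s => omega
  | @cons i n w c x hc _ ih =>
    rcases Nat.eq_zero_or_pos i with rfl | hi
    · rw [h0, Submodule.mem_bot] at hc
      simp [hc]
    · rw [ih (by omega), mul_zero]

theorem lengthFiltration_eq_bot (h0 : G.piece 0 = ⊥) (w : ℕ) :
    G.lengthFiltration (w + 1) w = ⊥ :=
  (Submodule.span_eq_bot).2 fun _ ⟨_, hn, hx⟩ => hx.eq_zero h0 hn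

/-- A linear map between tensor algebras that preserves the degree and raises the length by at
least `e`. -/
def RaisesLength (G' : BimodGrading k S C' ℕ) (G : BimodGrading k S C ℕ) (e : ℕ)
    (R : BimodTensor k S C' →ₗ[k] BimodTensor k S C) : Prop :=
  ∀ p w, ∀ x ∈ G'.lengthFiltration p w, R x ∈ G.lengthFiltration (p + e) w

variable {G}

theorem raisesLength_of_isWord {e : ℕ} {R : BimodTensor k S C' →ₗ[k] BimodTensor k S C}
    (h : ∀ n w x, G'.IsWord n w x → R x ∈ G.lengthFiltration (n + e) w) :
    RaisesLength G' G e R := by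
  intro p w x hx
  induction hx using Submodule.span_induction with
  | mem x hx =>
    obtain ⟨n, hn, hx⟩ := hx
    exact G.lengthFiltration_anti (by omega) _ (h n w x hx)
  | zero => simp
  | add a b _ _ ha hb => rw [map_add]; exact add_mem ha hb
  | smul r a _ ha => rw [map_smul]; exact Submodule.smul_mem _ _ ha

theorem raisesLength_algHom (u : BimodTensor k S C' →ₐ[k] BimodTensor k S C)
    (hS : ∀ s, u (inS k S C' s) = inS k S C s)
    (hC : ∀ i, ∀ c ∈ G'.piece i, u (inC k S C' c) ∈ G.lengthFiltration 1 i) :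
    RaisesLength G' G 0 u.toLinearMap :=
  raisesLength_of_isWord fun n w x hx => by
    induction hx with
    | inS s => simpa [hS] using G.inS_mem_lengthFiltration s
    | @cons i n w c x hc _ ih =>
      rw [AlgHom.toLinearMap_apply, map_mul]
      exact G.lengthFiltration_anti (by omega) _ (G.mul_mem_lengthFiltration (hC i c hc) ih)

end BimodGrading

/-- A `(u, v)`-derivation over `S`. -/
structure IsTwistedDerivation {A : Type*} [Ring A] [Algebra k A] (u v : BimodTensor k S C →ₐ[k] A)
    (K : BimodTensor k S C →ₗ[k] A) : Prop where
  inS : ∀ s, K (inS k S C s) = 0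
  mul : ∀ x y, K (x * y) = K x * v y + u x * K y

/-- The matrix `!![u, K; 0, v]` is multiplicative exactly when `K` satisfies the twisted Leibniz
rule, so `K` comes from the universal property with values in `2 × 2` matrices. -/
theorem exists_isTwistedDerivation {A : Type*} [Ring A] [Algebra k A]
    (u v : BimodTensor k S C →ₐ[k] A) (huv : ∀ s, u (inS k S C s) = v (inS k S C s))
    (δ : C →ₗ[k] A) (hl : ∀ s c, δ (s • c) = u (inS k S C s) * δ c)
    (hr : ∀ s c, δ (MulOpposite.op s • c) = δ c * v (inS k S C s)) :
    ∃ K, IsTwistedDerivation u v K ∧ ∀ c, K (inC k S C c) = δ c := by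
  let Θ : BimodTensor k S C →ₐ[k] Matrix (Fin 2) (Fin 2) A :=
    lift ((Matrix.diagonalAlgHom k).comp ((Pi.constAlgHom k (Fin 2) _).comp (v.comp (inS k S C))))
      { toFun := fun c => !![u (inC k S C c), δ c; 0, v (inC k S C c)]
        map_add' := fun c d => by
          ext i j; fin_cases i <;> fin_cases j <;> simp
        map_smul' := fun r c => by
          ext i j; fin_cases i <;> fin_cases j <;> simp }
      (fun s c => by
        ext i j
        fin_cases i <;> fin_cases j <;> simp [Matrix.mul_apply, inC_smul, hl, huv])
      (fun s c => by
        ext i j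
        fin_cases i <;> fin_cases j <;> simp [Matrix.mul_apply, inC_op_smul, hr, huv])
  have hΘ : ∀ x, Θ x 0 0 = u x ∧ Θ x 1 0 = 0 ∧ Θ x 1 1 = v x := fun x => by
    induction x using BimodTensor.induction with
    | hS t => simp [Θ, huv]
    | hC c => simp [Θ]
    | hadd a b ha hb => simp [ha, hb]
    | hmul a b ha hb => simp [Matrix.mul_apply, ha, hb]
  refine ⟨⟨⟨fun x => Θ x 0 1, by simp⟩, by simp⟩, ⟨fun s => ?_, fun x y => ?_⟩, fun c => ?_⟩
  · simp [Θ]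
  · simp [Matrix.mul_apply, hΘ, add_comm]
  · simp [Θ]

namespace IsTwistedDerivation

section

variable {A : Type*} [Ring A] [Algebra k A] {u v : BimodTensor k S C →ₐ[k] A}
    {K L : BimodTensor k S C →ₗ[k] A}

theorem sub (hK : IsTwistedDerivation u v K) (hL : IsTwistedDerivation u v L) :
    IsTwistedDerivation u v (K - L) :=
  ⟨fun s => by simp [hK.inS, hL.inS], fun x y => by
    simp only [LinearMap.sub_apply, hK.mul, hL.mul, sub_mul, mul_sub]; abel⟩

/-- By `u x u y - v x v y = (u x - v x) v y + u x (u y - v y)`, comparing two algebra maps reduces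
to generators, just as for derivations. -/
theorem of_algHom_sub (h : ∀ s, u (BimodTensor.inS k S C s) = v (BimodTensor.inS k S C s)) :
    IsTwistedDerivation u v (u.toLinearMap - v.toLinearMap) :=
  ⟨fun s => by simp [h], fun x y => by simp [sub_mul, mul_sub]⟩

theorem of_algHom_sub' (h : ∀ s, u (BimodTensor.inS k S C s) = v (BimodTensor.inS k S C s)) :
    IsTwistedDerivation u v (v.toLinearMap - u.toLinearMap) :=
  ⟨fun s => by simp [h], fun x y => by simp [sub_mul, mul_sub]⟩

theorem ext (hK : IsTwistedDerivation u v K) (hL : IsTwistedDerivation u v L)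
    (h : ∀ c, K (inC k S C c) = L (inC k S C c)) (x : BimodTensor k S C) : K x = L x := by
  induction x using BimodTensor.induction with
  | hS s => rw [hK.inS, hL.inS]
  | hC c => exact h c
  | hadd x y hx hy => rw [map_add, map_add, hx, hy]
  | hmul x y hx hy => rw [hK.mul, hL.mul, hx, hy]

end

/-- Each term of the Leibniz expansion on a word applies `K` to one letter, which gains `e`, and `u`
or `v` to the others, which lose no length. -/
theorem raisesLength {u v : BimodTensor k S C' →ₐ[k] BimodTensor k S C}
    {K : BimodTensor k S C' →ₗ[k] BimodTensor k S C} (hK : IsTwistedDerivation u v K)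
    {G' : BimodGrading k S C' ℕ} {G : BimodGrading k S C ℕ} {e : ℕ}
    (hu : ∀ i, ∀ c ∈ G'.piece i, u (inC k S C' c) ∈ G.lengthFiltration 1 i)
    (hv : BimodGrading.RaisesLength G' G 0 v.toLinearMap)
    (hC : ∀ i, ∀ c ∈ G'.piece i, K (inC k S C' c) ∈ G.lengthFiltration (1 + e) i) :
    BimodGrading.RaisesLength G' G e K :=
  BimodGrading.raisesLength_of_isWord fun n w x hx => by
    induction hx with
    | inS s => rw [hK.inS]; exact zero_mem _
    | @cons i n w c x hc hx ih =>
      rw [hK.mul]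
      exact add_mem
        (G.lengthFiltration_anti (by omega) _
          (G.mul_mem_lengthFiltration (hC i c hc) (hv _ _ _ hx.mem)))
        (G.lengthFiltration_anti (by omega) _ (G.mul_mem_lengthFiltration (hu i c hc) ih))

end IsTwistedDerivation

end LengthFiltration

/-! ### Bigraded bimodule maps and the algebra maps they induce. -/

section BigradedMaps

variable {k S C C' C'' : Type*} [Field k] [Ring S] [Algebra k S]
  [AddCommGroup C] [Module k C] [Module S C] [Module Sᵐᵒᵖ C]
  [AddCommGroup C'] [Module k C'] [Module S C'] [Module Sᵐᵒᵖ C']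
  [AddCommGroup C''] [Module k C''] [Module S C''] [Module Sᵐᵒᵖ C'']

/-- A homomorphism of bimodules that is homogeneous of degree `e` for the first grading and of
degree zero for the second one. -/
structure IsBigradedHom (gr : BimodGrading k S C ℤ) (gr' : BimodGrading k S C' ℤ)
    (G : BimodGrading k S C ℕ) (G' : BimodGrading k S C' ℕ) (e : ℤ) (L : C →ₗ[k] C') : Prop where
  smul : ∀ (s : S) c, L (s • c) = s • L c
  op_smul : ∀ (s : S) c, L (MulOpposite.op s • c) = MulOpposite.op s • L c
  mem_homological : ∀ n, ∀ c ∈ gr.piece n, L c ∈ gr'.piece (n + e)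
  mem_additional : ∀ i, ∀ c ∈ G.piece i, L c ∈ G'.piece i

namespace BimodGrading

theorem parity_parity (gr : BimodGrading k S C ℤ) (c : C) : gr.parity (gr.parity c) = c := by
  refine gr.induction_on c (fun n c hc => ?_) fun x y hx hy => by rw [map_add, map_add, hx, hy]
  rw [gr.parity_of_mem hc, map_zsmul, gr.parity_of_mem hc, smul_smul, ← Units.val_mul,
    Int.units_mul_self, Units.val_one, one_smul]

theorem parity_mem_of_le (gr : BimodGrading k S C ℤ) {V : Submodule k C}
    (hV : V ≤ ⨆ n, V ⊓ gr.piece n) {c : C} (hc : c ∈ V) : gr.parity c ∈ V := by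
  replace hc := hV hc
  induction hc using Submodule.iSup_induction' with
  | mem i x hx => rw [gr.parity_of_mem hx.2]; exact zsmul_mem hx.1 _
  | zero => simp
  | add x y _ _ hx hy => rw [map_add]; exact add_mem hx hy

theorem mem_piece_of_mem_tensorPiece_one [IsScalarTower k S C] [IsScalarTower k Sᵐᵒᵖ C]
    [SMulCommClass S Sᵐᵒᵖ C] {ι : Type*} [DecidableEq ι] [AddCommMonoid ι]
    (G : BimodGrading k S C ι) {i : ι} {x : BimodTensor k S C} (hx : x ∈ G.tensorPiece 1 i) :
    proj k S C x ∈ G.piece i := by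
  induction hx using Submodule.span_induction with
  | mem x hx =>
    obtain ⟨p, c, hc, hp, rfl⟩ := hx
    have := hc 0
    simp only [Finset.univ_unique, Fin.default_eq_zero, Fin.isValue, Finset.sum_singleton] at hp
    simpa [hp] using this
  | zero => simp
  | add a b _ _ ha hb => rw [map_add]; exact add_mem ha hb
  | smul r a _ ha => rw [map_smul]; exact Submodule.smul_mem _ _ ha

variable [IsScalarTower k S C] (gr : BimodGrading k S C ℤ) (G : BimodGrading k S C ℕ)

@[simp] theorem shiftParity_inS (s : S) : gr.shiftParity (inS k S C s) = inS k S C s := by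
  simp [shiftParity]

@[simp] theorem shiftParity_inC (c : C) :
    gr.shiftParity (inC k S C c) = -inC k S C (gr.parity c) := by
  simp [shiftParity]

theorem shiftParity_shiftParity (x : BimodTensor k S C) :
    gr.shiftParity (gr.shiftParity x) = x := by
  induction x using BimodTensor.induction with
  | hS s => simp
  | hC c => simp [gr.parity_parity]
  | hadd x y hx hy => simp [hx, hy]
  | hmul x y hx hy => simp [hx, hy]

variable {gr G} (hG : ∀ i, G.piece i ≤ ⨆ n, G.piece i ⊓ gr.piece n)
include hG

theorem shiftParity_inC_mem (i : ℕ) (c : C) (hc : c ∈ G.piece i) :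
    gr.shiftParity (inC k S C c) ∈ G.lengthFiltration 1 i := by
  rw [shiftParity_inC]
  exact neg_mem (G.inC_mem_lengthFiltration (gr.parity_mem_of_le (hG i) hc))

theorem raisesLength_shiftParity : RaisesLength G G 0 gr.shiftParity.toLinearMap :=
  raisesLength_algHom _ gr.shiftParity_inS (shiftParity_inC_mem hG)

theorem raisesLength_tensorParity : RaisesLength G G 0 gr.tensorParity.toLinearMap :=
  raisesLength_algHom _ (fun s => by simp [tensorParity]) fun i c hc => by
    have : gr.tensorParity (inC k S C c) = inC k S C (gr.parity c) := by simp [tensorParity]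
    rw [this]
    exact G.inC_mem_lengthFiltration (gr.parity_mem_of_le (hG i) hc)

/-- The suspension only inserts signs given by homological degrees. Condition `hG` keeps each
additional piece stable under these signs. -/
theorem suspension_mem_lengthFiltration {n i : ℕ} {x : BimodTensor k S C}
    (hx : x ∈ G.tensorPiece n i) : gr.suspension x ∈ G.lengthFiltration n i := by
  induction hx using Submodule.span_induction with
  | mem x hx =>
    obtain ⟨p, c, hc, rfl, rfl⟩ := hx
    induction n with
    | zero =>
      have h1 : gr.suspension (1 : BimodTensor k S C) = inS k S C 1 := by
        rw [← map_one (inS k S C), gr.suspension_inS]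
      simpa [h1] using G.inS_mem_lengthFiltration 1
    | succ n ih =>
      -- The last letter is split off because the suspension is recursive in multiplication on the
      -- right.
      rw [List.ofFn_succ', List.concat_eq_append, List.prod_append, List.prod_singleton,
        gr.suspension_mul_inC, Fin.sum_univ_castSucc]
      exact G.mul_mem_lengthFiltration
        (raisesLength_tensorParity hG _ _ _
          (ih (fun j => p j.castSucc) (fun j => c j.castSucc) fun j => hc _))
        (G.inC_mem_lengthFiltration (hc _))
  | zero => simp
  | add a b _ _ ha hb => rw [map_add]; exact add_mem ha hb
  | smul r a _ ha => rw [map_smul]; exact Submodule.smul_mem _ _ ha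

end BimodGrading

namespace IsBigradedHom

variable {gr : BimodGrading k S C ℤ} {gr' : BimodGrading k S C' ℤ} {gr'' : BimodGrading k S C'' ℤ}
  {G : BimodGrading k S C ℕ} {G' : BimodGrading k S C' ℕ} {G'' : BimodGrading k S C'' ℕ}

theorem parity {e : ℤ} {L : C →ₗ[k] C'} (hL : IsBigradedHom gr gr' G G' e L) (c : C) :
    gr'.parity (L c) = (e.negOnePow : ℤ) • L (gr.parity c) := by
  refine gr.induction_on c (fun n c hc => ?_) fun x y hx hy => by
    simp only [map_add, hx, hy, smul_add]
  rw [gr.parity_of_mem hc, gr'.parity_of_mem (hL.mem_homological n c hc), map_zsmul, smul_smul,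
    Int.negOnePow_add, Units.val_mul, mul_comm]

theorem comp {L : C' →ₗ[k] C''} {M : C →ₗ[k] C'} (hL : IsBigradedHom gr' gr'' G' G'' 0 L)
    (hM : IsBigradedHom gr gr' G G' 0 M) : IsBigradedHom gr gr'' G G'' 0 (L ∘ₗ M) where
  smul s c := by simp [hL.smul, hM.smul]
  op_smul s c := by simp [hL.op_smul, hM.op_smul]
  mem_homological n c hc := by
    simpa using hL.mem_homological _ _ (hM.mem_homological n c hc)
  mem_additional i c hc := hL.mem_additional i _ (hM.mem_additional i c hc)

variable [IsScalarTower k S C] [IsScalarTower k S C'] [IsScalarTower k S C'']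

/-- The homomorphism of tensor algebras induced by a homomorphism of bimodules. -/
def tensorMap {e : ℤ} {L : C →ₗ[k] C'} (hL : IsBigradedHom gr gr' G G' e L) :
    BimodTensor k S C →ₐ[k] BimodTensor k S C' :=
  lift (inS k S C') (inC k S C' ∘ₗ L) (fun s c => by simp [hL.smul, inC_smul])
    (fun s c => by simp [hL.op_smul, inC_op_smul])

@[simp] theorem tensorMap_inS {e : ℤ} {L : C →ₗ[k] C'} (hL : IsBigradedHom gr gr' G G' e L) (s : S) :
    hL.tensorMap (inS k S C s) = inS k S C' s := by simp [tensorMap]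

@[simp] theorem tensorMap_inC {e : ℤ} {L : C →ₗ[k] C'} (hL : IsBigradedHom gr gr' G G' e L) (c : C) :
    hL.tensorMap (inC k S C c) = inC k S C' (L c) := by simp [tensorMap]

theorem tensorMap_inC_mem {e : ℤ} {L : C →ₗ[k] C'} (hL : IsBigradedHom gr gr' G G' e L) (i : ℕ)
    (c : C) (hc : c ∈ G.piece i) : hL.tensorMap (inC k S C c) ∈ G'.lengthFiltration 1 i := by
  rw [tensorMap_inC]
  exact G'.inC_mem_lengthFiltration (hL.mem_additional i c hc)

theorem raisesLength_tensorMap {e : ℤ} {L : C →ₗ[k] C'} (hL : IsBigradedHom gr gr' G G' e L) :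
    BimodGrading.RaisesLength G G' 0 hL.tensorMap.toLinearMap :=
  BimodGrading.raisesLength_algHom _ hL.tensorMap_inS hL.tensorMap_inC_mem

theorem tensorMap_comp {L : C' →ₗ[k] C''} {M : C →ₗ[k] C'}
    (hL : IsBigradedHom gr' gr'' G' G'' 0 L) (hM : IsBigradedHom gr gr' G G' 0 M)
    (x : BimodTensor k S C) : (hL.comp hM).tensorMap x = hL.tensorMap (hM.tensorMap x) := by
  have : (hL.comp hM).tensorMap = hL.tensorMap.comp hM.tensorMap :=
    algHom_ext (fun s => by simp) fun c => by simp
  rw [this]; rfl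

theorem shiftParity_tensorMap {L : C →ₗ[k] C'} (hL : IsBigradedHom gr gr' G G' 0 L)
    (x : BimodTensor k S C) :
    gr'.shiftParity (hL.tensorMap x) = hL.tensorMap (gr.shiftParity x) := by
  have : gr'.shiftParity.comp hL.tensorMap = hL.tensorMap.comp gr.shiftParity :=
    algHom_ext (fun s => by simp) fun c => by simp [hL.parity]
  exact DFunLike.congr_fun this x

end IsBigradedHom

/-! ### Extending a homotopy to the tensor algebra. -/

section Homotopy

variable [IsScalarTower k S C] [IsScalarTower k S C']
  {gr : BimodGrading k S C ℤ} {gr' : BimodGrading k S C' ℤ}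
  {G : BimodGrading k S C ℕ} {G' : BimodGrading k S C' ℕ}

theorem IsTwistedDerivation.shiftParity_anticomm {u : BimodTensor k S C →ₐ[k] BimodTensor k S C}
    {K : BimodTensor k S C →ₗ[k] BimodTensor k S C}
    (hK : IsTwistedDerivation u (AlgHom.id k _) K)
    (hu : ∀ x, gr.shiftParity (u x) = u (gr.shiftParity x))
    (hC : ∀ c, gr.shiftParity (K (inC k S C c)) = -K (gr.shiftParity (inC k S C c)))
    (x : BimodTensor k S C) : gr.shiftParity (K x) = -K (gr.shiftParity x) := by
  induction x using BimodTensor.induction with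
  | hS s => simp [hK.inS]
  | hC c => exact hC c
  | hadd x y hx hy => simp only [map_add, hx, hy, neg_add]
  | hmul x y hx hy =>
    simp only [hK.mul, map_add, map_mul, hx, hy, hu, AlgHom.id_apply, neg_add, neg_mul, mul_neg]

/-- The derivation of the tensor algebra that extends `-Δ`. -/
theorem IsBigradedHom.exists_derivation {Δ : C →ₗ[k] C} {e : ℤ}
    (hΔ : IsBigradedHom gr gr G G e Δ) :
    ∃ D, IsTwistedDerivation gr.shiftParity (AlgHom.id k _) D ∧
      ∀ c, D (inC k S C c) = -inC k S C (Δ c) :=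
  exists_isTwistedDerivation _ _ (fun s => by simp) (-(inC k S C ∘ₗ Δ))
    (fun s c => by simp [hΔ.smul, inC_smul]) (fun s c => by simp [hΔ.op_smul, inC_op_smul])

/-- On a word, `K` is the signed sum of `t ⊗ ⋯ ⊗ t ⊗ h ⊗ 1 ⊗ ⋯ ⊗ 1`, the usual homotopy that
telescopes between the tensor powers of `t` and the identity. -/
theorem IsBigradedHom.exists_homotopy {t h : C →ₗ[k] C} {e : ℤ}
    (ht : IsBigradedHom gr gr G G 0 t) (hh : IsBigradedHom gr gr G G e h) :
    ∃ K, IsTwistedDerivation (gr.shiftParity.comp ht.tensorMap) (AlgHom.id k _) K ∧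
      ∀ c, K (inC k S C c) = inC k S C (h c) :=
  exists_isTwistedDerivation _ _ (fun s => by simp) (inC k S C ∘ₗ h)
    (fun s c => by simp [hh.smul, inC_smul]) (fun s c => by simp [hh.op_smul, inC_op_smul])

theorem IsBigradedHom.tensorMap_derivation {t : C →ₗ[k] C'} (ht : IsBigradedHom gr gr' G G' 0 t)
    {Δ : C →ₗ[k] C} {Δ' : C' →ₗ[k] C'} (hcomm : ∀ c, Δ' (t c) = t (Δ c))
    {D : BimodTensor k S C →ₗ[k] BimodTensor k S C}
    {D' : BimodTensor k S C' →ₗ[k] BimodTensor k S C'}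
    (hD : IsTwistedDerivation gr.shiftParity (AlgHom.id k _) D)
    (hDC : ∀ c, D (inC k S C c) = -inC k S C (Δ c))
    (hD' : IsTwistedDerivation gr'.shiftParity (AlgHom.id k _) D')
    (hDC' : ∀ c, D' (inC k S C' c) = -inC k S C' (Δ' c)) (x : BimodTensor k S C) :
    D' (ht.tensorMap x) = ht.tensorMap (D x) := by
  induction x using BimodTensor.induction with
  | hS s => simp [hD.inS, hD'.inS]
  | hC c => simp [hDC, hDC', hcomm]
  | hadd x y hx hy => simp only [map_add, hx, hy]
  | hmul x y hx hy =>
    simp only [map_mul, hD.mul, hD'.mul, map_add, hx, hy, AlgHom.id_apply,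
      ht.shiftParity_tensorMap]

/-- Both sides are `(T(t), id)`-derivations that agree on `C`. In the Leibniz expansion of `D K + K
D` the mixed terms cancel, since `D` and `K` anticommute with the sign automorphism and `T(t)`
commutes with it and with `D`. -/
theorem tensor_homotopy {Δ t h : C →ₗ[k] C} (hΔ : IsBigradedHom gr gr G G (-1) Δ)
    (ht : IsBigradedHom gr gr G G 0 t) (hh : IsBigradedHom gr gr G G 1 h)
    (hcomm : ∀ c, Δ (t c) = t (Δ c)) (hhom : ∀ c, Δ (h c) + h (Δ c) = c - t c)
    {D K : BimodTensor k S C →ₗ[k] BimodTensor k S C}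
    (hD : IsTwistedDerivation gr.shiftParity (AlgHom.id k _) D)
    (hDC : ∀ c, D (inC k S C c) = -inC k S C (Δ c))
    (hK : IsTwistedDerivation (gr.shiftParity.comp ht.tensorMap) (AlgHom.id k _) K)
    (hKC : ∀ c, K (inC k S C c) = inC k S C (h c)) (x : BimodTensor k S C) :
    D (K x) + K (D x) = ht.tensorMap x - x := by
  have hεD : ∀ x, gr.shiftParity (D x) = -D (gr.shiftParity x) :=
    hD.shiftParity_anticomm (fun _ => rfl) fun c => by simp [hDC, hΔ.parity]
  have hεK : ∀ x, gr.shiftParity (K x) = -K (gr.shiftParity x) :=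
    hK.shiftParity_anticomm (fun x => by
      simp only [AlgHom.comp_apply, ht.shiftParity_tensorMap]) fun c => by simp [hKC, hh.parity]
  have hτD := ht.tensorMap_derivation hcomm hD hDC hD hDC
  have h1 : IsTwistedDerivation ht.tensorMap (AlgHom.id k _) (D ∘ₗ K + K ∘ₗ D) :=
    ⟨fun s => by simp [hD.inS, hK.inS], fun x y => by
      simp only [LinearMap.add_apply, LinearMap.comp_apply, hD.mul, hK.mul, map_add,
        AlgHom.id_apply, AlgHom.comp_apply, ht.shiftParity_tensorMap, hεD, hεK, ← hτD,
        gr.shiftParity_shiftParity]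
      noncomm_ring⟩
  have h2 : IsTwistedDerivation ht.tensorMap (AlgHom.id k _)
      (ht.tensorMap.toLinearMap - (AlgHom.id k (BimodTensor k S C)).toLinearMap) :=
    IsTwistedDerivation.of_algHom_sub fun s => by simp
  refine h1.ext h2 (fun c => ?_) x
  have := congrArg (inC k S C) (hhom c)
  rw [map_add, map_sub] at this
  simp only [LinearMap.add_apply, LinearMap.comp_apply, hDC, hKC, map_neg, LinearMap.sub_apply,
    AlgHom.toLinearMap_apply, IsBigradedHom.tensorMap_inC, AlgHom.id_apply]
  rw [← neg_add, this, neg_sub]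

end Homotopy

end BigradedMaps

/-! ### The perturbation argument for the cobar construction. -/

section Cobar

variable {k S C C' : Type*} [Field k] [Ring S] [Algebra k S]
  [AddCommGroup C'] [Module k C'] [Module S C'] [Module Sᵐᵒᵖ C']
  [SMulCommClass S Sᵐᵒᵖ C'] [IsScalarTower k S C'] [IsScalarTower k Sᵐᵒᵖ C']
  [AddCommGroup C] [Module k C] [Module S C] [Module Sᵐᵒᵖ C]
  [SMulCommClass S Sᵐᵒᵖ C] [IsScalarTower k S C] [IsScalarTower k Sᵐᵒᵖ C]

namespace TensorFamily

variable {gr' : BimodGrading k S C' ℤ} {gr : BimodGrading k S C ℤ} {e : ℤ}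
  (F : TensorFamily gr' gr e) {G' : BimodGrading k S C' ℕ} {G : BimodGrading k S C ℕ}

theorem isBigradedHom_linearPart
    (hF : ∀ (n i : ℕ) (c : C'), c ∈ G'.piece i → F.comp n c ∈ G.tensorPiece n i) :
    IsBigradedHom gr' gr G' G (1 - e) F.linearPart where
  smul := F.linearPart_smul
  op_smul := F.linearPart_op_smul
  mem_homological n c hc := by
    have := gr.mem_piece_of_mem_tensorPiece_one (F.comp_mem 1 n c hc)
    rwa [Nat.cast_one] at this
  mem_additional i c hc := G.mem_piece_of_mem_tensorPiece_one (hF 1 i c hc)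

theorem total_sub_linearPart_mem (hG : ∀ i, G.piece i ≤ ⨆ n, G.piece i ⊓ gr.piece n)
    (hF : ∀ (n i : ℕ) (c : C'), c ∈ G'.piece i → F.comp n c ∈ G.tensorPiece n i) (i : ℕ) (c : C')
    (hc : c ∈ G'.piece i) :
    F.total c - inC k S C (F.linearPart c) ∈ G.lengthFiltration 2 i := by
  have h1 : gr.suspension (F.comp 1 c) = inC k S C (F.linearPart c) := by
    rw [← F.inC_linearPart, gr.suspension_inC]
  -- The index `1` is inserted so that the linear term can be split off even when it vanishes.
  have hs : (Function.support fun n => gr.suspension (F.comp n c)) ⊆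
      ↑(insert 1 (F.support_finite c).toFinset) := fun n hn => by simpa using Or.inr hn
  rw [F.total_apply, finsum_eq_sum_of_support_subset _ hs,
    ← Finset.add_sum_erase _ _ (Finset.mem_insert_self _ _), h1, add_sub_cancel_left]
  refine Submodule.sum_mem _ fun n hn => ?_
  rcases eq_or_ne n 0 with rfl | h0
  · simp [F.comp_zero]
  have hn1 := Finset.ne_of_mem_erase hn
  exact G.lengthFiltration_anti (by omega) _
    (BimodGrading.suspension_mem_lengthFiltration hG (hF n i c hc))

theorem total_mem (hG : ∀ i, G.piece i ≤ ⨆ n, G.piece i ⊓ gr.piece n)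
    (hF : ∀ (n i : ℕ) (c : C'), c ∈ G'.piece i → F.comp n c ∈ G.tensorPiece n i) (i : ℕ) (c : C')
    (hc : c ∈ G'.piece i) : F.total c ∈ G.lengthFiltration 1 i := by
  have := add_mem (G.lengthFiltration_anti one_le_two i (F.total_sub_linearPart_mem hG hF i c hc))
    (G.inC_mem_lengthFiltration ((F.isBigradedHom_linearPart hF).mem_additional i c hc))
  rwa [sub_add_cancel] at this

theorem isTwistedDerivation_derivation (F : TensorFamily gr gr e) :
    IsTwistedDerivation gr.shiftParity (AlgHom.id k _) F.derivation :=
  ⟨F.derivation_inS, F.derivation_mul⟩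

end TensorFamily

namespace IsHomotopyInverse

/-- Over a separable algebra, a homotopy inverse may be chosen to respect bimodule structures and
gradings. -/
theorem exists_isBigradedHom (hS : IsSeparableAlg k S)
    {gr' : BimodGrading k S C' ℤ} {gr : BimodGrading k S C ℤ}
    {G' : BimodGrading k S C' ℕ} {G : BimodGrading k S C ℕ}
    (hG' : ∀ i, G'.piece i ≤ ⨆ n, G'.piece i ⊓ gr'.piece n)
    (hG : ∀ i, G.piece i ≤ ⨆ n, G.piece i ⊓ gr.piece n)
    {d' : C' →ₗ[k] C'} {d : C →ₗ[k] C} {f : C' →ₗ[k] C}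
    (hd' : IsBigradedHom gr' gr' G' G' (-1) d') (hd : IsBigradedHom gr gr G G (-1) d)
    (hf : IsBigradedHom gr' gr G' G 0 f)
    {g : C →ₗ[k] C'} {h' : C' →ₗ[k] C'} {h : C →ₗ[k] C} (H : IsHomotopyInverse d' d f g h' h) :
    ∃ g h' h, IsHomotopyInverse d' d f g h' h ∧ IsBigradedHom gr gr' G G' 0 g ∧
      IsBigradedHom gr' gr' G' G' 1 h' ∧ IsBigradedHom gr gr G G 1 h := by
  obtain ⟨e, he1, he⟩ := hS.exists_idempotent
  -- Additional degree is treated before homological degree; since the additional pieces are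
  -- homologically graded, the second step preserves the first. Averaging comes last and keeps both,
  -- as all pieces are sub-bimodules.
  have H1 := H.homPart G' G id id (fun _ => rfl) (fun _ => rfl) hd'.mem_additional
    hd.mem_additional hf.mem_additional
  have H2 := H1.homPart gr' gr (fun n => n + -1) (fun n => n + 1) (fun n => by omega)
    (fun n => by omega) hd'.mem_homological hd.mem_homological
    (fun n c hc => by simpa using hf.mem_homological n c hc)
  have H3 := H2.bimodAvg he1 hd'.smul hd'.op_smul hd.smul hd.op_smul hf.smul hf.op_smul
  refine ⟨_, _, _, H3,
    ⟨bimodAvg_smul he _, bimodAvg_op_smul he _, fun n => bimodAvg_mem _ _ _ _ ?_,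
      fun i => bimodAvg_mem _ _ _ _ ?_⟩,
    ⟨bimodAvg_smul he _, bimodAvg_op_smul he _, fun n => bimodAvg_mem _ _ _ _ ?_,
      fun i => bimodAvg_mem _ _ _ _ ?_⟩,
    ⟨bimodAvg_smul he _, bimodAvg_op_smul he _, fun n => bimodAvg_mem _ _ _ _ ?_,
      fun i => bimodAvg_mem _ _ _ _ ?_⟩⟩
  · intro c hc
    simpa using gr.homPart_mem gr' id _ n c hc
  · exact gr.homPart_mem_of_le gr' _ _ (hG i) (hG' i) (G.homPart_mem G' id _ i)
  · exact gr'.homPart_mem gr' (fun n => n + 1) _ n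
  · exact gr'.homPart_mem_of_le gr' _ _ (hG' i) (hG' i) (G'.homPart_mem G' id _ i)
  · exact gr.homPart_mem gr (fun n => n + 1) _ n
  · exact gr.homPart_mem_of_le gr _ _ (hG i) (hG i) (G.homPart_mem G id _ i)

end IsHomotopyInverse

/-- The perturbed homotopy: if `D` and `Φ` agree with `D₁` and `Φ₁` up to terms of greater length,
then so do the expressions that compare `Φ U` with the identity. -/
theorem BimodGrading.raisesLength_tensor_homotopy
    {G : BimodGrading k S C ℕ}
    {D D₁ K W W₁ : BimodTensor k S C →ₗ[k] BimodTensor k S C}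
    (hD : RaisesLength G G 1 (D - D₁)) (hK : RaisesLength G G 0 K)
    (hW : RaisesLength G G 1 (W - W₁)) (hhom : ∀ x, D₁ (K x) + K (D₁ x) = W₁ x - x) (p w : ℕ)
    (x : BimodTensor k S C) (hx : x ∈ G.lengthFiltration p w) :
    W x - (D (K x) + K (D x)) - x ∈ G.lengthFiltration (p + 1) w := by
  -- The unperturbed homotopy identity cancels, leaving only the errors `W - W₁` and `D - D₁`, each
  -- of which raises length.
  have e : W x - (D (K x) + K (D x)) - x =
      (W - W₁) x - (D - D₁) (K x) - K ((D - D₁) x) := by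
    have := hhom x
    simp only [LinearMap.sub_apply, map_sub]
    rw [eq_sub_iff_add_eq] at this
    rw [← this]
    abel
  rw [e]
  exact sub_mem (sub_mem (hW _ _ _ hx) (hD _ _ _ (hK _ _ _ hx))) (hK _ _ _ (hD _ _ _ hx))

/-- The full and the linear derivation have the same twists, so their difference is again a twisted
derivation. On `C` it consists of the components with `n ≥ 2`. -/
theorem AInfCoalgebra.exists_linear_derivation (X : AInfCoalgebra k S C) (G : X.PositiveGrading) :
    ∃ D, IsTwistedDerivation X.gr.shiftParity (AlgHom.id k _) D ∧
      (∀ c, D (inC k S C c) = -inC k S C (X.Δ₁ c)) ∧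
      BimodGrading.RaisesLength G.toBimodGrading G.toBimodGrading 1 (X.Δ.derivation - D) := by
  have hΔ : IsBigradedHom X.gr X.gr G.toBimodGrading G.toBimodGrading (1 - 2) X.Δ₁ :=
    X.Δ.isBigradedHom_linearPart G.Δ_mem
  have hid : BimodGrading.RaisesLength G.toBimodGrading G.toBimodGrading 0
      (AlgHom.id k (BimodTensor k S C)).toLinearMap := fun _ _ _ h => h
  obtain ⟨D, hD, hDC⟩ := hΔ.exists_derivation
  refine ⟨D, hD, hDC, ?_⟩
  refine (X.Δ.isTwistedDerivation_derivation.sub hD).raisesLength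
    (BimodGrading.shiftParity_inC_mem G.isGraded) hid fun i c hc => ?_
  have := neg_mem (X.Δ.total_sub_linearPart_mem G.isGraded G.Δ_mem i c hc)
  rw [LinearMap.sub_apply, hDC, TensorFamily.derivation_inC, sub_neg_eq_add]
  rwa [neg_sub, sub_eq_neg_add] at this

theorem AInfCoalgebra.Hom.coneD_acyclic (hS : IsSeparableAlg k S)
    {X' : AInfCoalgebra k S C'} {X : AInfCoalgebra k S C} (f : AInfCoalgebra.Hom X' X)
    (G' : X'.PositiveGrading) (G : X.PositiveGrading) (hf : f.IsCompatible G' G)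
    (hqi : f.IsQuasiIso) (x : BimodTensor k S C' × BimodTensor k S C)
    (hx : coneD X'.Δ.derivation X.Δ.derivation f.comps.algHom.toLinearMap x = 0) :
    ∃ y, coneD X'.Δ.derivation X.Δ.derivation f.comps.algHom.toLinearMap y = x := by
  have hd' : IsBigradedHom X'.gr X'.gr G'.toBimodGrading G'.toBimodGrading (-1) X'.Δ₁ :=
    X'.Δ.isBigradedHom_linearPart G'.Δ_mem
  have hd : IsBigradedHom X.gr X.gr G.toBimodGrading G.toBimodGrading (-1) X.Δ₁ :=
    X.Δ.isBigradedHom_linearPart G.Δ_mem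
  have hf₁ : IsBigradedHom X'.gr X.gr G'.toBimodGrading G.toBimodGrading 0 f.f₁ :=
    f.comps.isBigradedHom_linearPart hf
  have hfc : ∀ c, X.Δ₁ (f.f₁ c) = f.f₁ (X'.Δ₁ c) := fun c => (LinearMap.congr_fun f.f₁_comm c).symm
  obtain ⟨_, _, _, H₀⟩ := hqi.exists_isHomotopyInverse X'.Δ₁_comp_Δ₁ X.Δ₁_comp_Δ₁
  obtain ⟨g, h', h, H, hg, hh', hh⟩ :=
    H₀.exists_isBigradedHom hS G'.isGraded G.isGraded hd' hd hf₁
  obtain ⟨D₁', hD₁', hDC', hD₁'1⟩ := X'.exists_linear_derivation G'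
  obtain ⟨D₁, hD₁, hDC, hD₁1⟩ := X.exists_linear_derivation G
  have ht' := hg.comp hf₁
  have ht := hf₁.comp hg
  obtain ⟨K', hK', hKC'⟩ := ht'.exists_homotopy hh'
  obtain ⟨K, hK, hKC⟩ := ht.exists_homotopy hh
  have hhom' := tensor_homotopy hd' ht' hh'
    (fun c => by simp only [LinearMap.comp_apply, H.comm, hfc])
    H.left hD₁' hDC' hK' hKC'
  have hhom := tensor_homotopy hd ht hh
    (fun c => by simp only [LinearMap.comp_apply, ← H.comm, hfc])
    H.right hD₁ hDC hK hKC
  have hK'0 : BimodGrading.RaisesLength G'.toBimodGrading G'.toBimodGrading 0 K' :=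
    hK'.raisesLength (fun i c hc => BimodGrading.raisesLength_shiftParity G'.isGraded _ _ _
      (ht'.tensorMap_inC_mem i c hc)) (fun _ _ _ h => h) fun i c hc => by
        rw [hKC']; exact G'.inC_mem_lengthFiltration (hh'.mem_additional i c hc)
  have hK0 : BimodGrading.RaisesLength G.toBimodGrading G.toBimodGrading 0 K :=
    hK.raisesLength (fun i c hc => BimodGrading.raisesLength_shiftParity G.isGraded _ _ _
      (ht.tensorMap_inC_mem i c hc)) (fun _ _ _ h => h) fun i c hc => by
        rw [hKC]; exact G.inC_mem_lengthFiltration (hh.mem_additional i c hc)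
  have hΦ0 : BimodGrading.RaisesLength G'.toBimodGrading G.toBimodGrading 0
      f.comps.algHom.toLinearMap :=
    BimodGrading.raisesLength_algHom _ f.comps.algHom_inS fun i c hc => by
      rw [TensorFamily.algHom_inC]; exact f.comps.total_mem G.isGraded hf i c hc
  have hΦ1 : BimodGrading.RaisesLength G'.toBimodGrading G.toBimodGrading 1
      (f.comps.algHom.toLinearMap - hf₁.tensorMap.toLinearMap) :=
    (IsTwistedDerivation.of_algHom_sub' fun s => by simp).raisesLength hf₁.tensorMap_inC_mem hΦ0
      fun i c hc => by
        rw [LinearMap.sub_apply, AlgHom.toLinearMap_apply, AlgHom.toLinearMap_apply,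
          TensorFamily.algHom_inC, IsBigradedHom.tensorMap_inC]
        exact f.comps.total_sub_linearPart_mem G.isGraded hf i c hc
  have hU0 := hg.raisesLength_tensorMap
  refine cone_acyclic_of_filtered _ _ _ (LinearMap.congr_fun X'.d_comp_d)
    (LinearMap.congr_fun X.d_comp_d) (LinearMap.congr_fun f.comm)
    hg.tensorMap.toLinearMap K' K
    G'.lengthFiltration G.lengthFiltration
    G'.iSup_lengthFiltration G.iSup_lengthFiltration
    (G'.lengthFiltration_eq_bot G'.piece_zero) (G.lengthFiltration_eq_bot G.piece_zero)
    (fun p => G'.lengthFiltration_anti p.le_succ) (fun p => G.lengthFiltration_anti p.le_succ)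
    ?_ (fun p w y hy => ?_) ?_
    (fun p w y hy => sub_mem (hΦ0 _ _ _ (hK'0 _ _ _ hy)) (hK0 _ _ _ (hΦ0 _ _ _ hy))) x hx
  · refine BimodGrading.raisesLength_tensor_homotopy
      (W := hg.tensorMap.toLinearMap ∘ₗ f.comps.algHom.toLinearMap)
      (W₁ := ht'.tensorMap.toLinearMap) hD₁'1 hK'0 (fun p w y hy => ?_) hhom'
    have h := hU0 _ _ _ (hΦ1 _ _ _ hy)
    rw [LinearMap.sub_apply, map_sub] at h
    have e : ht'.tensorMap y = hg.tensorMap (hf₁.tensorMap y) := hg.tensorMap_comp hf₁ y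
    rw [LinearMap.sub_apply, AlgHom.toLinearMap_apply ht'.tensorMap, e]
    exact h
  -- `T(g)` intertwines the linear derivations exactly, so only their length-raising errors
  -- contribute.
  · have e : hg.tensorMap (X.Δ.derivation y) - X'.Δ.derivation (hg.tensorMap y) =
        hg.tensorMap ((X.Δ.derivation - D₁) y) - (X'.Δ.derivation - D₁') (hg.tensorMap y) := by
      simp only [LinearMap.sub_apply, map_sub,
        hg.tensorMap_derivation H.comm hD₁ hDC hD₁' hDC']
      abel
    rw [AlgHom.toLinearMap_apply, AlgHom.toLinearMap_apply, e]
    exact sub_mem (hU0 _ _ _ (hD₁1 _ _ _ hy)) (hD₁'1 _ _ _ (hU0 _ _ _ hy))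
  · refine BimodGrading.raisesLength_tensor_homotopy
      (W := f.comps.algHom.toLinearMap ∘ₗ hg.tensorMap.toLinearMap)
      (W₁ := ht.tensorMap.toLinearMap) hD₁1 hK0 (fun p w y hy => ?_) hhom
    have h := hΦ1 _ _ _ (hU0 _ _ _ hy)
    have e : ht.tensorMap y = hf₁.tensorMap (hg.tensorMap y) := hf₁.tensorMap_comp hg y
    rw [LinearMap.sub_apply, AlgHom.toLinearMap_apply ht.tensorMap, e]
    exact h

end Cobar

end

theorem corollary6p3 {k S C' C : Type*} [Field k] [Ring S] [Algebra k S]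
    (hS : IsSeparableAlg k S)
    [AddCommGroup C'] [Module k C'] [Module S C'] [Module Sᵐᵒᵖ C']
    [SMulCommClass S Sᵐᵒᵖ C'] [IsScalarTower k S C'] [IsScalarTower k Sᵐᵒᵖ C']
    [AddCommGroup C] [Module k C] [Module S C] [Module Sᵐᵒᵖ C]
    [SMulCommClass S Sᵐᵒᵖ C] [IsScalarTower k S C] [IsScalarTower k Sᵐᵒᵖ C]
    (X' : AInfCoalgebra k S C') (X : AInfCoalgebra k S C) (f : AInfCoalgebra.Hom X' X)
    (G' : X'.PositiveGrading) (G : X.PositiveGrading) (hf : f.IsCompatible G' G)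
    (hqi : f.IsQuasiIso) : f.IsWeakEquivalence := by
  refine (isQuasiIsoOf_iff_cone _ _ _ _).2 ?_
  rintro ⟨⟨x', hx'⟩, ⟨x, hx⟩⟩ h0
  have h1 : coneD X'.Δ.derivation X.Δ.derivation f.comps.algHom.toLinearMap (x', x) = 0 :=
    Prod.ext (congrArg (Subtype.val ∘ Prod.fst) h0) (congrArg (Subtype.val ∘ Prod.snd) h0)
  obtain ⟨⟨y', y⟩, hy⟩ := f.coneD_acyclic hS G' G hf hqi _ h1
  have hy1 : -X'.Δ.derivation y' = x' := congrArg Prod.fst hy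
  have hy2 : f.comps.algHom y' + X.Δ.derivation y = x := congrArg Prod.snd hy
  -- The preimage from the unital cone is moved into the augmentation ideals. Its first entry is
  -- already there, since `f.comps.algHom` preserves the augmentation and the derivation has
  -- augmentation zero. The `S`-part of the second entry may be subtracted because the derivation
  -- kills `S`.
  have haug : BimodTensor.aug k S C' y' = 0 := by
    have := congrArg (BimodTensor.aug k S C) hy2
    rwa [map_add, f.comps.aug_algHom, X.Δ.aug_derivation, add_zero, BimodTensor.mem_plus.1 hx] at this
  refine ⟨(⟨y', haug⟩, ⟨y - BimodTensor.inS k S C (BimodTensor.aug k S C y),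
    by simp [BimodTensor.mem_plus]⟩), ?_⟩
  refine Prod.ext (Subtype.ext hy1) (Subtype.ext ?_)
  change f.comps.algHom y' + X.Δ.derivation (y - BimodTensor.inS k S C (BimodTensor.aug k S C y)) = x
  rw [map_sub, TensorFamily.derivation_inS, sub_zero, hy2]
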